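/- Let $T>0$, $\alpha\in(0,1]$, $c\in(0,2^{\alpha-1})$, $\lambda>(\alpha-1)/T$, and put $\nu=c\,\Gamma(\alpha)$ and $f_n(x)=c\,e^{-\lambda x/n}x^{\alpha-1}$ for $n,x\in\mathbb N=\{1,2,\dots\}$. For $n\in\mathbb N$, a binary sequence $(\xi_i^{(*,n)})_{i\in\mathbb N}$ is called GBP$^*(f_n)$ if, with $i_0=0$, $$P\big(\xi^{(*,n)}_{i_1}=\dots=\xi^{(*,n)}_{i_k}=1\big)=\prod_{j=1}^{k}f_n(i_j-i_{j-1})\qquad(1\le i_1<\dots<i_k).$$ For $b\in(0,1]$, a binary sequence $(\xi_i^{(n)})_{1\le i\le\lfloor nT\rfloor}$ is called GBP$(f_n)$ if $$P\big(\xi^{(n)}_{i_1}=\dots=\xi^{(n)}_{i_k}=1\big)=b\,f_n(\lfloor nT\rfloor)\prod_{j=2}^{k}f_n(i_j-i_{j-1})\qquad(k\ge 1,\ 1\le i_1<\dots<i_k\le\lfloor nT\rfloor).$$ Let $(X^*_t)_{t>0}$ be the limit, in the sense of weak convergence of all finite-dimensional distributions as $n\to\infty$, of the scaled random walks $n^{-\alpha}\sum_{i\le\lfloor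 nt\rfloor}\xi^{(*,n)}_i$ whose steps are GBP$^*(f_n)$ for all large $n$ (the existence of these sequences on all of $\mathbb N$ forces $\lambda\ge 0$). Let $(X_t)_{0<t\le T}$ be the limit, in the same sense, of $n^{-\alpha}\sum_{i\le\lfloor nt\rfloor}\xi^{(n)}_i$ whose steps are GBP$(f_n)$ for all large $n$, and let $a_T=c\,b\,e^{-\lambda T}T^{\alpha-1}$. For $d>0$ write $\nabla X^*_t=X^*_t-X^*_{t-d}$ and $\nabla X_t=X_t-X_{t-d}$; as $d\to0^+$, $g(d)\sim h(d)$ means $g(d)/h(d)\to1$. All expectations below are finite (those of increments for all small $d$), and the following hold. **(i)** For every integer $k\ge1$ and $t>0$, $$\mathrm E\big((X_t^*)^k\big)=t^{k\alpha}\frac{k!\,\nu^k}{\Gamma(k\alpha)}\int_0^1e^{-\lambda ty}y^{k\alpha-1}\,dy .$$ For $0<t<s$, $$\mathrm E(X_s^*X_t^*)=s^{2\alpha}c^2\int_{t/s}^1\int_0^{t/s}x_1^{\alpha-1}(x_2-x_1)^{\alpha-1}e^{-\lambda sx_2}\,dx_1dx_2+t^{2\alpha}\frac{2\nu^2}{\Gamma(2\alpha)}\int_0^1e^{-\lambda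 ty}y^{2\alpha-1}\,dy ,$$ $$\mathrm{cov}(X_s^*,X_t^*)=s^{2\alpha}c^2\int_{t/s}^1\int_0^{t/s}x_1^{\alpha-1}(x_2-x_1)^{\alpha-1}e^{-\lambda sx_2}\,dx_1dx_2+t^{2\alpha}\frac{2\nu^2}{\Gamma(2\alpha)}\int_0^1e^{-\lambda ty}y^{2\alpha-1}\,dy-(ts)^{\alpha}c^2\int_0^1e^{-\lambda ty}y^{\alpha-1}dy\int_0^1e^{-\lambda sx}x^{\alpha-1}dx .$$ **(ii)** For all $s,t>0$, as $d\to0^+$, $$\mathrm E(\nabla X_s^*\,\nabla X_{s+t}^*)\sim c^2d^2e^{-\lambda(s+t)}s^{\alpha-1}t^{\alpha-1}.$$ For every $m\in\mathbb N$, $0=t_0<t_1<\dots<t_m$ and integers $k_1,\dots,k_m\ge1$, as $d\to0^+$, $$\mathrm E\Big(\prod_{i=1}^m(\nabla X^*_{t_i})^{k_i}\Big)\sim d^{\,\sum_{i=1}^m(\alpha(k_i-1)+1)}\,e^{-\lambda t_m}\prod_{i=1}^m\Big\{\frac{k_i!\,\nu^{k_i-1}}{\Gamma((k_i-1)\alpha+2)}\,c\,(t_i-t_{i-1})^{\alpha-1}\Big\},$$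 and, if moreover $t_m\le T$, $$\lim_{d\to0^+}\frac{\mathrm E\big(\prod_{i=1}^m(\nabla X^*_{t_i})^{k_i}\big)}{\prod_{i=1}^m\mathrm E\big((\nabla X_{t_i})^{k_i}\big)}=e^{-\lambda t_m}\Big(\frac{c}{a_T}\Big)^m\prod_{i=1}^m(t_i-t_{i-1})^{\alpha-1}.$$ -/

import Mathlib

open MeasureTheory ProbabilityTheory Filter Topology Asymptotics

noncomputable section

/-- The function `f_n(x) = c exp(-lam x / n) x^(α-1)` that drives the generalized Bernoulli
processes. -/
def temperedPower (α c lam : ℝ) (n x : ℕ) : ℝ :=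
  c * Real.exp (-lam * x / n) * (x : ℝ) ^ (α - 1)

/-- For sites `i 0 < i 1 < ⋯ < i k`, the product of `f` over the gaps between consecutive sites. -/
def gapProd (f : ℕ → ℝ) {k : ℕ} (i : Fin (k + 1) → ℕ) : ℝ :=
  ∏ j : Fin k, f (i j.succ - i j.castSucc)

/-- `ξ 1, …, ξ N` is a (stationary) generalized Bernoulli process GBP(`f`) with parameter `b`:
a binary sequence with
`P(ξ (i 0) = 1, …, ξ (i k) = 1) = b f(N) ∏_{j < k} f(i (j+1) - i j)` for
`1 ≤ i 0 < ⋯ < i k ≤ N`. As the variables are binary, these probabilities determine the joint law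
of `ξ 1, …, ξ N` through the inclusion-exclusion principle. -/
structure IsGBP {Ω : Type*} [MeasurableSpace Ω] (P : Measure Ω) (f : ℕ → ℝ) (b : ℝ) (N : ℕ)
    (ξ : ℕ → Ω → ℝ) : Prop where
  aemeasurable : ∀ i ∈ Finset.Icc 1 N, AEMeasurable (ξ i) P
  binary : ∀ i ∈ Finset.Icc 1 N, ∀ᵐ ω ∂P, ξ i ω = 0 ∨ ξ i ω = 1
  prob : ∀ (k : ℕ) (i : Fin (k + 1) → ℕ), StrictMono i → (∀ j, i j ∈ Finset.Icc 1 N) →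
    P.real (⋂ j, {ω | ξ (i j) ω = 1}) = b * f N * gapProd f i

/-- `ξ 1, ξ 2, …` is a nonstationary generalized Bernoulli process GBP*(`f`): the
binary sequence that a GBP(`f`) shows after a site that carries a `1`. That is,
`P(ξ (i 1) = 1, …, ξ (i k) = 1)` is the conditional probability that the shifted sites
`i 1 + 1 < ⋯ < i k + 1` of a GBP carry a `1`, given that site `1` does; the factor `b f(N)` cancels
and there remains `∏_{j < k} f(i (j+1) - i j)`, where `i 0 = 0`. -/
structure IsGBPStar {Ω : Type*} [MeasurableSpace Ω] (P : Measure Ω) (f : ℕ → ℝ)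
    (ξ : ℕ → Ω → ℝ) : Prop where
  aemeasurable : ∀ i, 1 ≤ i → AEMeasurable (ξ i) P
  binary : ∀ i, 1 ≤ i → ∀ᵐ ω ∂P, ξ i ω = 0 ∨ ξ i ω = 1
  prob : ∀ (k : ℕ) (i : Fin (k + 1) → ℕ), StrictMono i → i 0 = 0 →
    P.real (⋂ j : Fin k, {ω | ξ (i j.succ) ω = 1}) = gapProd f i

/-- The scaled random walk `n^(-α) ∑_{1 ≤ i ≤ ⌊n t⌋} ξ i`. -/
def scaledWalk {Ω : Type*} (α : ℝ) (n : ℕ) (ξ : ℕ → Ω → ℝ) (t : ℝ) (ω : Ω) : ℝ :=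
  (∑ i ∈ Finset.Icc 1 ⌊n * t⌋₊, ξ i ω) / (n : ℝ) ^ α

/-- All finite-dimensional distributions of the processes `W n`, at times in `S`, converge weakly to
those of the process `X`. -/
def TendstoFDD {Ω' : ℕ → Type*} [∀ n, MeasurableSpace (Ω' n)] (P : (n : ℕ) → Measure (Ω' n))
    [∀ n, IsProbabilityMeasure (P n)] (W : (n : ℕ) → ℝ → Ω' n → ℝ)
    {Ω : Type*} [MeasurableSpace Ω] (μ : Measure Ω) [IsProbabilityMeasure μ]
    (X : ℝ → Ω → ℝ) (S : Set ℝ) : Prop :=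
  ∀ (m : ℕ) (t : Fin m → ℝ), (∀ i, t i ∈ S) →
    TendstoInDistribution (fun n ω i ↦ W n (t i) ω) atTop (fun ω i ↦ X (t i) ω) P μ

/-- `X = (X_t)_{0 < t ≤ T}` is the limiting process of the scaled random walks whose steps
`ξ n 1, …, ξ n ⌊n T⌋` follow GBP(`f_n`) with parameter `b`. -/
structure IsWalkLimit (α c lam b T : ℝ)
    {Ω' : ℕ → Type*} [∀ n, MeasurableSpace (Ω' n)] (P : (n : ℕ) → Measure (Ω' n))
    [∀ n, IsProbabilityMeasure (P n)] (ξ : (n : ℕ) → ℕ → Ω' n → ℝ)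
    {Ω : Type*} [MeasurableSpace Ω] (μ : Measure Ω) [IsProbabilityMeasure μ]
    (X : ℝ → Ω → ℝ) : Prop where
  steps : ∀ᶠ n : ℕ in atTop, IsGBP (P n) (temperedPower α c lam n) b ⌊n * T⌋₊ (ξ n)
  limit : TendstoFDD P (fun n ↦ scaledWalk α n (ξ n)) μ X (Set.Ioc 0 T)

/-- `X = (X_t)_{t > 0}` is the limiting process of the scaled random walks whose steps
`ξ n 1, ξ n 2, …` follow GBP*(`f_n`). -/
structure IsWalkLimitStar (α c lam : ℝ)
    {Ω' : ℕ → Type*} [∀ n, MeasurableSpace (Ω' n)] (P : (n : ℕ) → Measure (Ω' n))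
    [∀ n, IsProbabilityMeasure (P n)] (ξ : (n : ℕ) → ℕ → Ω' n → ℝ)
    {Ω : Type*} [MeasurableSpace Ω] (μ : Measure Ω) [IsProbabilityMeasure μ]
    (X : ℝ → Ω → ℝ) : Prop where
  steps : ∀ᶠ n : ℕ in atTop, IsGBPStar (P n) (temperedPower α c lam n) (ξ n)
  limit : TendstoFDD P (fun n ↦ scaledWalk α n (ξ n)) μ X (Set.Ioi 0)

end

/-!
The moments of the limits are computed from the discrete walks. For `0`-`1` variables, the falling
factorial of the number of successes in a block `(a, b]` counts, up to `k!`, the chains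
`q₁ < ⋯ < q_k` of occupied sites in that block. The defining property of a GBP* says that the mean
number of chains through consecutive blocks is the sum of the gap products
`∏ f (q_j - q_{j-1})` (`IsGBPStar.integral_prod_descPochhammer`); for a GBP, the first site
contributes the stationary probability instead (`IsGBP.integral_descPochhammer`).

Summed backwards from the last site, these weights are iterated one-dimensional sums. Divided by
`n ^ α` per site, each of the sums is the integral of a step function that `u ^ (α - 1)` dominates,
because rounding up only decreases this power. So the sums converge to the iterated integrals of
`c exp(-λ u) u ^ (α - 1)`, where the exponentials telescope (`tendsto_scaled_sum`,
`chainWeight_scaling`). Powers differ from falling factorials by terms of lower order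
(`tendsto_integral_prod_pow_mul_descPochhammer`). As all moments converge, so do in particular the
second moments of the products at hand, and the limits in distribution inherit the first moments
(`MeasureTheory.TendstoInDistribution.integrable_and_integral_eq`).

What remains is about the iterated integrals. Over one interval they are iterates of a fractional
integral, with kernel `(c Γ(α)) ^ k u ^ (k α - 1) / Γ(k α)` by the beta integral
(`chainPotential_replicate`); this gives the moments, and with one exchange of integrals the
covariances (`chainPotential_pair`). Over short blocks `(t_i - d, t_i]`, the kernel between two
blocks is squeezed between its values at the gaps `t_i - t_{i-1} ± d`, and the exponentials are
constant up to a factor `exp(± |λ| d)`. So the integral factorizes asymptotically into one factor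
for each block (`chainPotential_blockList_isEquivalent`), and the same block integral appears for
the stationary process (`integral_exp_mul_chainPotential_isEquivalent`), so that it cancels in the
quotient.
-/

/-! ### Chains of occupied sites -/

/-- The total weight of the chains `p < q₁ < ⋯ < q_r` with `q_j` in the `j`-th interval
`(a_j, b_j]` of the list, where a chain weighs `∏ f (q_j - q_{j-1})` with `q₀ = p`. -/
noncomputable def chainWeight (f : ℕ → ℝ) : List (ℕ × ℕ) → ℕ → ℝ
  | [], _ => 1
  | J :: l, p => ∑ q ∈ Finset.Ioc (max J.1 p) J.2, f (q - p) * chainWeight f l q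

/-- For a binary sequence `x`, the number of chains `p < q₁ < ⋯ < q_r` of sites that carry a `1`,
with `q_j` in the `j`-th interval `(a_j, b_j]` of the list. -/
noncomputable def chainCount (x : ℕ → ℝ) : List (ℕ × ℕ) → ℕ → ℝ
  | [], _ => 1
  | J :: l, p => ∑ q ∈ Finset.Ioc (max J.1 p) J.2, x q * chainCount x l q

/-- The list in which `J 0` is repeated `k 0` times, then `J 1` is repeated `k 1` times, and so
on. -/
def blockList {β : Type*} {m : ℕ} (k : Fin m → ℕ) (J : Fin m → β) : List β :=
  (List.ofFn fun i ↦ List.replicate (k i) (J i)).flatten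

lemma blockList_succ {β : Type*} {m : ℕ} (k : Fin (m + 1) → ℕ) (J : Fin (m + 1) → β) :
    blockList k J = List.replicate (k 0) (J 0) ++
      blockList (fun i ↦ k i.succ) (fun i ↦ J i.succ) := by
  simp [blockList, List.ofFn_succ]

lemma map_blockList {β γ : Type*} {m : ℕ} (k : Fin m → ℕ) (J : Fin m → β) (g : β → γ) :
    (blockList k J).map g = blockList k (fun i ↦ g (J i)) := by
  induction m with
  | zero => simp [blockList]
  | succ m ih => rw [blockList_succ, blockList_succ, List.map_append, ih, List.map_replicate]

lemma length_blockList {β : Type*} {m : ℕ} (k : Fin m → ℕ) (J : Fin m → β) :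
    (blockList k J).length = ∑ i, k i := by
  induction m with
  | zero => simp [blockList]
  | succ m ih => rw [blockList_succ, List.length_append, ih, List.length_replicate,
      Fin.sum_univ_succ]

lemma mem_blockList {β : Type*} {m : ℕ} {k : Fin m → ℕ} {J : Fin m → β} {b : β}
    (h : b ∈ blockList k J) : ∃ i, b = J i := by
  induction m with
  | zero => simp [blockList] at h
  | succ m ih =>
    rw [blockList_succ, List.mem_append] at h
    rcases h with h | h
    · exact ⟨0, List.eq_of_mem_replicate h⟩
    · obtain ⟨i, hi⟩ := ih h
      exact ⟨i.succ, hi⟩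

lemma gapProd_snoc (f : ℕ → ℝ) {k : ℕ} (i : Fin (k + 1) → ℕ) (q : ℕ) :
    gapProd f (Fin.snoc (α := fun _ ↦ ℕ) i q : Fin (k + 2) → ℕ) =
      gapProd f i * f (q - i (Fin.last k)) := by
  unfold gapProd
  rw [Fin.prod_univ_castSucc]
  congr 1
  · refine Finset.prod_congr rfl fun j _ ↦ ?_
    rw [← Fin.castSucc_succ, Fin.snoc_castSucc, Fin.snoc_castSucc]
  · rw [Fin.succ_last, Fin.snoc_last, Fin.snoc_castSucc]

lemma strictMono_snoc {k : ℕ} {i : Fin (k + 1) → ℕ} (hi : StrictMono i) {q : ℕ}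
    (hq : i (Fin.last k) < q) :
    StrictMono (Fin.snoc (α := fun _ ↦ ℕ) i q : Fin (k + 2) → ℕ) := by
  rw [Fin.strictMono_iff_lt_succ]
  intro j
  induction j using Fin.lastCases with
  | last => rw [Fin.succ_last, Fin.snoc_last, Fin.snoc_castSucc]; exact hq
  | cast j =>
    rw [← Fin.castSucc_succ, Fin.snoc_castSucc, Fin.snoc_castSucc]
    exact hi Fin.castSucc_lt_succ

/-! ### Essentially bounded random variables -/

section Bounded

variable {Ω : Type*} [MeasurableSpace Ω] {P : Measure Ω}

lemma memLp_top_of_binary {x : Ω → ℝ} (hx : AEMeasurable x P)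
    (hb : ∀ᵐ ω ∂P, x ω = 0 ∨ x ω = 1) : MemLp x ⊤ P :=
  memLp_top_of_bound hx.aestronglyMeasurable 1 (by
    filter_upwards [hb] with ω h
    rcases h with h | h <;> simp [h])

lemma memLp_top_mul {x y : Ω → ℝ} (hx : MemLp x ⊤ P) (hy : MemLp y ⊤ P) :
    MemLp (fun ω ↦ x ω * y ω) ⊤ P := hy.mul hx

lemma memLp_top_prod [IsFiniteMeasure P] {ι : Type*} (s : Finset ι) {x : ι → Ω → ℝ}
    (hx : ∀ i ∈ s, MemLp (x i) ⊤ P) : MemLp (fun ω ↦ ∏ i ∈ s, x i ω) ⊤ P := by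
  classical
  induction s using Finset.induction_on with
  | empty => simpa using memLp_const (1 : ℝ)
  | insert i s his ih =>
    simp_rw [Finset.prod_insert his]
    exact memLp_top_mul (hx i (by simp)) (ih fun j hj ↦ hx j (by simp [hj]))

lemma memLp_top_pow [IsFiniteMeasure P] {x : Ω → ℝ} (hx : MemLp x ⊤ P) (k : ℕ) :
    MemLp (fun ω ↦ x ω ^ k) ⊤ P := by
  simpa using memLp_top_prod (Finset.range k) (x := fun _ ↦ x) fun _ _ ↦ hx

lemma memLp_top_descPochhammer [IsFiniteMeasure P] {x : Ω → ℝ} (hx : MemLp x ⊤ P) (k : ℕ) :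
    MemLp (fun ω ↦ (descPochhammer ℝ k).eval (x ω)) ⊤ P := by
  induction k with
  | zero => simpa using memLp_const (1 : ℝ)
  | succ k ih =>
    simp_rw [descPochhammer_succ_eval]
    exact memLp_top_mul ih (hx.sub (memLp_const (k : ℝ)))

lemma memLp_top_chainCount [IsFiniteMeasure P] {ξ : ℕ → Ω → ℝ} (l : List (ℕ × ℕ))
    (p : ℕ) (hξ : ∀ q, p < q → (∃ J ∈ l, q ≤ J.2) → MemLp (ξ q) ⊤ P) :
    MemLp (fun ω ↦ chainCount (fun q ↦ ξ q ω) l p) ⊤ P := by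
  induction l generalizing p with
  | nil => simpa [chainCount] using memLp_const (1 : ℝ)
  | cons J l ih =>
    simp only [chainCount]
    refine memLp_finsetSum _ fun q hq ↦ ?_
    simp only [Finset.mem_Ioc, max_lt_iff] at hq
    refine memLp_top_mul (hξ q hq.1.2 ⟨J, by simp, hq.2⟩) (ih q fun r hr hJ ↦ ?_)
    obtain ⟨J', hJ', h⟩ := hJ
    exact hξ r (by omega) ⟨J', by simp [hJ'], h⟩

end Bounded

/-! ### Expected number of chains -/

/-- If the mixed moments of `ξ` along increasing sequences of sites that start at `p₀` are the gap
products of `f`, up to a constant factor, then the mean number of chains is the total weight. -/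
lemma integral_prod_mul_chainCount {Ω : Type*} [MeasurableSpace Ω] {P : Measure Ω}
    [IsFiniteMeasure P] {ξ : ℕ → Ω → ℝ} {f : ℕ → ℝ} {C : ℝ} {p₀ N : ℕ}
    (hξ : ∀ q, p₀ ≤ q → q ≤ N → MemLp (ξ q) ⊤ P)
    (H : ∀ (k : ℕ) (i : Fin (k + 1) → ℕ), StrictMono i → i 0 = p₀ → (∀ j, i j ≤ N) →
      ∫ ω, ∏ j, ξ (i j) ω ∂P = C * gapProd f i)
    (l : List (ℕ × ℕ)) (hl : ∀ J ∈ l, J.2 ≤ N) (k : ℕ) (i : Fin (k + 1) → ℕ) (hi : StrictMono i)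
    (hi0 : i 0 = p₀) (hiN : ∀ j, i j ≤ N) :
    ∫ ω, (∏ j, ξ (i j) ω) * chainCount (fun q ↦ ξ q ω) l (i (Fin.last k)) ∂P =
      C * gapProd f i * chainWeight f l (i (Fin.last k)) := by
  induction l generalizing k with
  | nil => simpa [chainCount, chainWeight] using H k i hi hi0 hiN
  | cons J l ih =>
    have hstep : ∀ q ∈ Finset.Ioc (max J.1 (i (Fin.last k))) J.2,
        Integrable (fun ω ↦ (∏ j, ξ (i j) ω) * (ξ q ω * chainCount (fun q ↦ ξ q ω) l q)) P ∧
        ∫ ω, (∏ j, ξ (i j) ω) * (ξ q ω * chainCount (fun q ↦ ξ q ω) l q) ∂P =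
          C * gapProd f i * (f (q - i (Fin.last k)) * chainWeight f l q) := by
      intro q hq
      simp only [Finset.mem_Ioc, max_lt_iff] at hq
      have hlast : p₀ ≤ i (Fin.last k) := hi0 ▸ hi.monotone (Fin.zero_le _)
      have hqN : q ≤ N := hq.2.trans (hl J (by simp))
      constructor
      · refine MemLp.integrable (q := ⊤) le_top ?_
        refine memLp_top_mul (memLp_top_prod _ fun j _ ↦ hξ _ ?_ (hiN j))
          (memLp_top_mul (hξ q (by omega) hqN) (memLp_top_chainCount l q ?_))
        · exact hi0 ▸ hi.monotone (Fin.zero_le _)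
        · rintro r hr ⟨J', hJ', h⟩
          exact hξ r (by omega) (h.trans (hl J' (by simp [hJ'])))
      · have := ih (fun J' hJ' ↦ hl J' (by simp [hJ'])) (k + 1)
          (Fin.snoc (α := fun _ ↦ ℕ) i q) (strictMono_snoc hi hq.1.2)
          (by
            have : (0 : Fin (k + 2)) = Fin.castSucc 0 := rfl
            rw [this, Fin.snoc_castSucc, hi0])
          (by
            intro j
            induction j using Fin.lastCases with
            | last => rw [Fin.snoc_last]; exact hqN
            | cast j => rw [Fin.snoc_castSucc]; exact hiN j)
        rw [gapProd_snoc, Fin.snoc_last] at this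
        simp_rw [Fin.prod_univ_castSucc (n := k + 1), Fin.snoc_castSucc, Fin.snoc_last] at this
        simp_rw [← mul_assoc] at this ⊢
        exact this
    simp only [chainCount, chainWeight, Finset.mul_sum]
    rw [integral_finsetSum _ fun q hq ↦ (hstep q hq).1]
    exact Finset.sum_congr rfl fun q hq ↦ (hstep q hq).2

/-! ### Chains and falling factorials -/

lemma descPochhammer_eval_add_one (k : ℕ) (s : ℝ) :
    (descPochhammer ℝ (k + 1)).eval (s + 1) =
      (descPochhammer ℝ (k + 1)).eval s + (k + 1) * (descPochhammer ℝ k).eval s := by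
  have h : (descPochhammer ℝ (k + 1)).eval (s + 1) = (s + 1) * (descPochhammer ℝ k).eval s := by
    rw [descPochhammer_succ_left]
    simp [Polynomial.eval_comp]
  rw [h, descPochhammer_succ_eval]
  ring

/-- Splitting the `k + 1` element sets of occupied sites in `(M, B]` by their least element. -/
lemma sum_mul_descPochhammer {x : ℕ → ℝ} {A B : ℕ}
    (hx : ∀ q ∈ Finset.Ioc A B, x q = 0 ∨ x q = 1) (k : ℕ) {M : ℕ} (hAM : A ≤ M) (hMB : M ≤ B) :
    ∑ q ∈ Finset.Ioc M B, x q * (descPochhammer ℝ k).eval (∑ r ∈ Finset.Ioc q B, x r) =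
      (descPochhammer ℝ (k + 1)).eval (∑ r ∈ Finset.Ioc M B, x r) / (k + 1) := by
  induction hMB using Nat.decreasingInduction with
  | of_succ M hM ih =>
    have hsplit : Finset.Ioc M B = insert (M + 1) (Finset.Ioc (M + 1) B) := by
      ext q; simp only [Finset.mem_Ioc, Finset.mem_insert]; omega
    have hni : M + 1 ∉ Finset.Ioc (M + 1) B := by simp
    rw [hsplit, Finset.sum_insert hni, Finset.sum_insert hni, ih (by omega)]
    have hk : (k : ℝ) + 1 ≠ 0 := by positivity
    rcases hx (M + 1) (by simp only [Finset.mem_Ioc]; omega) with h | h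
    · simp [h]
    · rw [h, add_comm (1 : ℝ), descPochhammer_eval_add_one]
      field_simp
      ring
  | self => simp

lemma chainCount_replicate_append {x : ℕ → ℝ} {A B : ℕ} (hAB : A ≤ B)
    (hx : ∀ q ∈ Finset.Ioc A B, x q = 0 ∨ x q = 1) {l : List (ℕ × ℕ)} {v : ℝ}
    (hl : ∀ q ≤ B, chainCount x l q = v) (k : ℕ) {p : ℕ} (hp : p ≤ B) :
    chainCount x (List.replicate k (A, B) ++ l) p =
      (descPochhammer ℝ k).eval (∑ q ∈ Finset.Ioc (max A p) B, x q) / k.factorial * v := by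
  induction k generalizing p with
  | zero => simp [hl p hp]
  | succ k ih =>
    rw [List.replicate_succ, List.cons_append, chainCount]
    have : ∀ q ∈ Finset.Ioc (max A p) B, x q * chainCount x (List.replicate k (A, B) ++ l) q =
        x q * (descPochhammer ℝ k).eval (∑ r ∈ Finset.Ioc q B, x r) *
          (v / k.factorial) := by
      intro q hq
      simp only [Finset.mem_Ioc, max_lt_iff] at hq
      rw [ih hq.2, max_eq_right (by omega)]
      ring
    rw [Finset.sum_congr rfl this, ← Finset.sum_mul,
      sum_mul_descPochhammer hx k (le_max_left _ _) (by omega), Nat.factorial_succ]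
    push_cast
    field_simp

/-- For consecutive blocks `(a i, b i]`, the chains with `k i` sites in the `i`-th block are counted
by a product of binomial coefficients. -/
lemma chainCount_blockList {x : ℕ → ℝ} {m : ℕ} (k a b : Fin m → ℕ)
    (hx : ∀ i, ∀ q ∈ Finset.Ioc (a i) (b i), x q = 0 ∨ x q = 1)
    (hab : ∀ i, a i ≤ b i) (hba : ∀ i j, i < j → b i ≤ a j) {p : ℕ} (hp : ∀ i, p ≤ a i) :
    chainCount x (blockList k fun i ↦ (a i, b i)) p =
      ∏ i, (descPochhammer ℝ (k i)).eval (∑ q ∈ Finset.Ioc (a i) (b i), x q) /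
        (k i).factorial := by
  induction m generalizing p with
  | zero => simp [blockList, chainCount]
  | succ m ih =>
    rw [blockList_succ, Fin.prod_univ_succ,
      chainCount_replicate_append (hab 0) (hx 0)
        (fun q hq ↦ ih (fun i ↦ k i.succ) (fun i ↦ a i.succ) (fun i ↦ b i.succ)
          (fun i ↦ hx i.succ) (fun i ↦ hab i.succ)
          (fun i j hij ↦ hba _ _ (Fin.succ_lt_succ_iff.2 hij))
          fun i ↦ hq.trans (hba 0 i.succ (Fin.succ_pos i))) (k 0) ((hp 0).trans (hab 0)),
      max_eq_left (hp 0)]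

/-! ### Factorial moments of generalized Bernoulli processes -/

section Factorial

variable {Ω : Type*} [MeasurableSpace Ω] {P : Measure Ω}

lemma integral_prod_of_binary {ι : Type*} [Fintype ι] {x : ι → Ω → ℝ}
    (hx : ∀ i, AEMeasurable (x i) P) (hb : ∀ i, ∀ᵐ ω ∂P, x i ω = 0 ∨ x i ω = 1) :
    ∫ ω, ∏ i, x i ω ∂P = P.real (⋂ i, {ω | x i ω = 1}) := by
  have hmeas : NullMeasurableSet (⋂ i, {ω | x i ω = 1}) P :=
    NullMeasurableSet.iInter fun i ↦ (hx i).nullMeasurableSet_preimage (measurableSet_singleton 1)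
  have hae : (fun ω ↦ ∏ i, x i ω) =ᵐ[P] (⋂ i, {ω | x i ω = 1}).indicator fun _ ↦ (1 : ℝ) := by
    filter_upwards [ae_all_iff.2 hb] with ω h
    by_cases hω : ω ∈ ⋂ i, {ω | x i ω = 1}
    · rw [Set.indicator_of_mem hω]
      exact Finset.prod_eq_one fun i _ ↦ Set.mem_iInter.1 hω i
    · rw [Set.indicator_of_notMem hω]
      simp only [Set.mem_iInter, not_forall, Set.mem_ofPred_eq] at hω
      obtain ⟨i, hi⟩ := hω
      exact Finset.prod_eq_zero (Finset.mem_univ i) ((h i).resolve_right hi)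
  rw [integral_congr_ae hae, integral_indicator₀ hmeas]
  simp

variable [IsProbabilityMeasure P] {f : ℕ → ℝ} {ξ : ℕ → Ω → ℝ}

/-- Joint factorial moments of the numbers of successes of a GBP* in consecutive blocks. -/
lemma IsGBPStar.integral_prod_descPochhammer (h : IsGBPStar P f ξ) {m : ℕ} (k a b : Fin m → ℕ)
    (hab : ∀ i, a i ≤ b i) (hba : ∀ i j, i < j → b i ≤ a j) :
    ∫ ω, ∏ i, (descPochhammer ℝ (k i)).eval (∑ q ∈ Finset.Ioc (a i) (b i), ξ q ω) ∂P =
      (∏ i, ((k i).factorial : ℝ)) * chainWeight f (blockList k fun i ↦ (a i, b i)) 0 := by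
  -- the origin counts as a site that carries a `1`
  set ζ : ℕ → Ω → ℝ := fun q ω ↦ if q = 0 then 1 else ξ q ω with hζ
  have hζξ : ∀ q, 1 ≤ q → ζ q = ξ q := fun q hq ↦ by
    funext ω; simp [hζ, Nat.one_le_iff_ne_zero.1 hq]
  have hmem : ∀ q, MemLp (ζ q) ⊤ P := by
    intro q
    rcases Nat.eq_zero_or_pos q with rfl | hq
    · simpa [hζ] using memLp_const (1 : ℝ)
    · rw [hζξ q hq]
      exact memLp_top_of_binary (h.aemeasurable q hq) (h.binary q hq)
  have hbl : ∀ J ∈ blockList k fun i ↦ (a i, b i), J.2 ≤ ∑ i, b i := by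
    intro J hJ
    obtain ⟨i, rfl⟩ := mem_blockList hJ
    exact Finset.single_le_sum (f := b) (fun _ _ ↦ Nat.zero_le _) (Finset.mem_univ i)
  have key := integral_prod_mul_chainCount (P := P) (ξ := ζ) (f := f) (C := 1) (p₀ := 0)
    (N := ∑ i, b i) (fun q _ _ ↦ hmem q) (by
      intro k i hi hi0 _
      have hpos : ∀ j : Fin k, 1 ≤ i j.succ := fun j ↦ by
        have := hi (Fin.succ_pos j); omega
      rw [one_mul, ← h.prob k i hi hi0, ← integral_prod_of_binary
        (fun j ↦ h.aemeasurable _ (hpos j)) (fun j ↦ h.binary _ (hpos j))]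
      refine integral_congr_ae (ae_of_all _ fun ω ↦ ?_)
      simp only [Fin.prod_univ_succ, hi0]
      rw [show ζ 0 ω = 1 by simp [hζ], one_mul]
      exact Finset.prod_congr rfl fun j _ ↦ by rw [hζξ _ (hpos j)])
    (blockList k fun i ↦ (a i, b i)) hbl 0 (fun _ ↦ 0) (fun i j hij ↦ by omega) rfl (by simp)
  have hfac : (∏ i, ((k i).factorial : ℝ)) ≠ 0 :=
    Finset.prod_ne_zero_iff.2 fun i _ ↦ by positivity
  have hbin : ∀ᵐ ω ∂P, ∀ q, 1 ≤ q → ξ q ω = 0 ∨ ξ q ω = 1 :=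
    ae_all_iff.2 fun q ↦ by
      by_cases hq : 1 ≤ q
      · filter_upwards [h.binary q hq] with ω hω _ using hω
      · exact ae_of_all _ fun ω hq' ↦ absurd hq' hq
  have hae : (fun ω ↦ (∏ j : Fin 1, ζ 0 ω) *
        chainCount (fun q ↦ ζ q ω) (blockList k fun i ↦ (a i, b i)) 0) =ᵐ[P]
      fun ω ↦ (∏ i, (descPochhammer ℝ (k i)).eval (∑ q ∈ Finset.Ioc (a i) (b i), ξ q ω)) /
        ∏ i, ((k i).factorial : ℝ) := by
    filter_upwards [hbin] with ω hω
    have hsum : ∀ i, ∑ q ∈ Finset.Ioc (a i) (b i), ζ q ω =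
        ∑ q ∈ Finset.Ioc (a i) (b i), ξ q ω := fun i ↦
      Finset.sum_congr rfl fun q hq ↦ by
        rw [hζξ q (by simp only [Finset.mem_Ioc] at hq; omega)]
    rw [chainCount_blockList k a b _ hab hba (fun i ↦ Nat.zero_le _), Finset.prod_div_distrib]
    · simp_rw [hsum]
      simp [hζ]
    · intro i q hq
      have hq1 : 1 ≤ q := by simp only [Finset.mem_Ioc] at hq; omega
      rw [hζξ q hq1]
      exact hω q hq1
  have hgap : gapProd f (fun _ : Fin 1 ↦ 0) = 1 := by simp [gapProd]
  rw [integral_congr_ae hae, integral_div, hgap, div_eq_iff hfac] at key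
  rw [key]
  ring

/-- Factorial moments of the number of successes of a GBP in a block: the first success has the
stationary probability `b * f N`, and the later ones form a chain that starts there. -/
lemma IsGBP.integral_descPochhammer {β : ℝ} {N : ℕ} (h : IsGBP P f β N ξ) (k : ℕ) {a b : ℕ}
    (hab : a ≤ b) (hbN : b ≤ N) :
    ∫ ω, (descPochhammer ℝ (k + 1)).eval (∑ q ∈ Finset.Ioc a b, ξ q ω) ∂P =
      (k + 1).factorial * (β * f N * ∑ q ∈ Finset.Ioc a b,
        chainWeight f (List.replicate k (a, b)) q) := by
  have hI : ∀ q, 1 ≤ q → q ≤ N → q ∈ Finset.Icc 1 N := fun q h1 h2 ↦ Finset.mem_Icc.2 ⟨h1, h2⟩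
  have hmem : ∀ q, 1 ≤ q → q ≤ N → MemLp (ξ q) ⊤ P := fun q h1 h2 ↦
    memLp_top_of_binary (h.aemeasurable q (hI q h1 h2)) (h.binary q (hI q h1 h2))
  have hbin : ∀ᵐ ω ∂P, ∀ q, q ∈ Finset.Icc 1 N → ξ q ω = 0 ∨ ξ q ω = 1 :=
    ae_all_iff.2 fun q ↦ by
      by_cases hq : q ∈ Finset.Icc 1 N
      · filter_upwards [h.binary q hq] with ω hω _ using hω
      · exact ae_of_all _ fun ω hq' ↦ absurd hq' hq
  have hae : (fun ω ↦ (descPochhammer ℝ (k + 1)).eval (∑ q ∈ Finset.Ioc a b, ξ q ω)) =ᵐ[P]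
      fun ω ↦ (k + 1).factorial * ∑ q ∈ Finset.Ioc a b,
        ξ q ω * chainCount (fun q ↦ ξ q ω) (List.replicate k (a, b)) q := by
    filter_upwards [hbin] with ω hω
    have := chainCount_replicate_append (x := fun q ↦ ξ q ω) hab (l := []) (v := 1)
      (fun q hq ↦ hω q (by simp only [Finset.mem_Ioc, Finset.mem_Icc] at hq ⊢; omega))
      (fun q _ ↦ by simp [chainCount]) (k + 1) (Nat.zero_le b)
    rw [List.append_nil, List.replicate_succ, chainCount, Nat.max_zero, mul_one] at this
    rw [this]
    field_simp
  have hstep : ∀ q ∈ Finset.Ioc a b,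
      Integrable (fun ω ↦ ξ q ω * chainCount (fun q ↦ ξ q ω) (List.replicate k (a, b)) q) P ∧
      ∫ ω, ξ q ω * chainCount (fun q ↦ ξ q ω) (List.replicate k (a, b)) q ∂P =
        β * f N * chainWeight f (List.replicate k (a, b)) q := by
    intro q hq
    simp only [Finset.mem_Ioc] at hq
    have hJ : ∀ J ∈ List.replicate k (a, b), J.2 ≤ N := fun J hJ ↦ by
      rw [List.eq_of_mem_replicate hJ]; exact hbN
    constructor
    · refine MemLp.integrable (q := ⊤) le_top (memLp_top_mul (hmem q (by omega) (by omega))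
        (memLp_top_chainCount _ q ?_))
      rintro r hr ⟨J, hJ', hrJ⟩
      exact hmem r (by omega) (hrJ.trans (hJ J hJ'))
    · have key := integral_prod_mul_chainCount (P := P) (ξ := ξ) (f := f) (C := β * f N) (p₀ := q)
        (N := N) (fun r h1 h2 ↦ hmem r (by omega) h2) (by
          intro k i hi hi0 hiN
          have hi1 : ∀ j, i j ∈ Finset.Icc 1 N := fun j ↦
            hI _ (by have := hi.monotone (Fin.zero_le j); omega) (hiN j)
          rw [← h.prob k i hi hi1]
          exact integral_prod_of_binary (fun j ↦ h.aemeasurable _ (hi1 j))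
            fun j ↦ h.binary _ (hi1 j))
        (List.replicate k (a, b)) hJ 0 (fun _ ↦ q) (fun i j hij ↦ by omega) rfl
        (fun _ ↦ by omega)
      have hgap : gapProd f (fun _ : Fin 1 ↦ q) = 1 := by simp [gapProd]
      rw [hgap, mul_one] at key
      simpa using key
  rw [integral_congr_ae hae, integral_const_mul, integral_finsetSum _ fun q hq ↦ (hstep q hq).1,
    Finset.sum_congr rfl fun q hq ↦ (hstep q hq).2, ← Finset.mul_sum]

end Factorial

/-! ### Scaling limit of the chain weights -/

lemma setIntegral_comp_ceil (g : ℕ → ℝ) {n : ℕ} (hn : 0 < n) (R : ℕ) :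
    IntegrableOn (fun u : ℝ ↦ g ⌈n * u⌉₊) (Set.Ioc 0 (R / n : ℝ)) ∧
    ∫ u in Set.Ioc (0 : ℝ) (R / n), g ⌈n * u⌉₊ = (∑ r ∈ Finset.Icc 1 R, g r) / n := by
  have hn' : (0 : ℝ) < n := by exact_mod_cast hn
  induction R with
  | zero => simp
  | succ R ih =>
    have h0 : (0 : ℝ) ≤ R / n := by positivity
    have h1 : (R / n : ℝ) ≤ (R + 1 : ℕ) / n := by gcongr; simp
    have heq : Set.EqOn (fun u : ℝ ↦ g ⌈n * u⌉₊) (fun _ ↦ g (R + 1))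
        (Set.Ioc (R / n : ℝ) ((R + 1 : ℕ) / n)) := by
      intro u hu
      have h2 : (R : ℝ) < n * u := by
        have := (div_lt_iff₀ hn').1 hu.1
        linarith
      have h3 : n * u ≤ (R + 1 : ℕ) := by
        have := (le_div_iff₀ hn').1 hu.2
        linarith
      have : ⌈n * u⌉₊ = R + 1 := by
        rw [Nat.ceil_eq_iff (by omega)]
        exact ⟨by simpa using h2, h3⟩
      simp only [this]
    have hint : IntegrableOn (fun u : ℝ ↦ g ⌈n * u⌉₊)
        (Set.Ioc (R / n : ℝ) ((R + 1 : ℕ) / n)) :=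
      (integrableOn_congr_fun heq measurableSet_Ioc).2 (by simp)
    rw [← Set.Ioc_union_Ioc_eq_Ioc h0 h1]
    refine ⟨ih.1.union hint, ?_⟩
    rw [setIntegral_union (Set.Ioc_disjoint_Ioc_of_le le_rfl) measurableSet_Ioc ih.1 hint, ih.2,
      setIntegral_congr_fun measurableSet_Ioc heq, setIntegral_const,
      Finset.sum_Icc_succ_top (by omega)]
    rw [Real.volume_real_Ioc_of_le h1, smul_eq_mul]
    push_cast
    field_simp
    ring

/-- A sum over the sites in `(max A p, B]` as an integral of a step function. -/
lemma sum_Ioc_max_eq_setIntegral (w U : ℕ → ℝ) {n : ℕ} (hn : 0 < n) (A B p : ℕ) {b : ℝ}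
    (hb : (B : ℝ) ≤ n * b) :
    (∑ q ∈ Finset.Ioc (max A p) B, w (q - p) * U q) / n =
      ∫ u in Set.Ioc 0 b, if A < p + ⌈n * u⌉₊ ∧ p + ⌈n * u⌉₊ ≤ B then
        w ⌈n * u⌉₊ * U (p + ⌈n * u⌉₊) else 0 := by
  have hn' : (0 : ℝ) < n := by exact_mod_cast hn
  set g : ℕ → ℝ := fun r ↦ if A < p + r ∧ p + r ≤ B then w r * U (p + r) else 0 with hg
  have hsum : ∑ q ∈ Finset.Ioc (max A p) B, w (q - p) * U q = ∑ r ∈ Finset.Icc 1 B, g r := by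
    rw [hg, ← Finset.sum_filter]
    refine Finset.sum_bij' (fun q _ ↦ q - p) (fun r _ ↦ p + r) ?_ ?_ ?_ ?_ ?_
    · intro q hq
      simp only [Finset.mem_Ioc, max_lt_iff, Finset.mem_filter, Finset.mem_Icc] at hq ⊢
      omega
    · intro r hr
      simp only [Finset.mem_Ioc, max_lt_iff, Finset.mem_filter, Finset.mem_Icc] at hr ⊢
      omega
    · intro q hq
      simp only [Finset.mem_Ioc, max_lt_iff] at hq
      omega
    · intro r hr
      omega
    · intro q hq
      simp only [Finset.mem_Ioc, max_lt_iff] at hq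
      rw [show p + (q - p) = q by omega]
  rw [hsum, ← (setIntegral_comp_ceil g hn B).2]
  symm
  refine setIntegral_eq_of_subset_of_forall_sdiff_eq_zero measurableSet_Ioc
    (Set.Ioc_subset_Ioc_right ((div_le_iff₀ hn').2 (by linarith))) ?_
  intro u hu
  have hu' : (B / n : ℝ) < u := by
    by_contra hcon
    exact hu.2 ⟨hu.1.1, not_lt.1 hcon⟩
  have : B < ⌈n * u⌉₊ := Nat.lt_ceil.2 (by
    have := (div_lt_iff₀ hn').1 hu'
    linarith)
  exact if_neg (by omega)

lemma rpow_mul_temperedPower (α c lam : ℝ) {n r : ℕ} (hn : 0 < n) :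
    temperedPower α c lam n r / (n : ℝ) ^ α * n =
      c * Real.exp (-lam * (r / n)) * (r / n : ℝ) ^ (α - 1) := by
  have hn' : (0 : ℝ) < n := by exact_mod_cast hn
  rw [temperedPower, Real.div_rpow (Nat.cast_nonneg r) hn'.le, Real.rpow_sub_one hn'.ne',
    mul_div_assoc (-lam)]
  field_simp

lemma tendsto_add_ceil_div {p : ℕ → ℕ} {x : ℝ} (hp : Tendsto (fun n ↦ (p n : ℝ) / n) atTop (𝓝 x))
    {u : ℝ} (hu : 0 ≤ u) :
    Tendsto (fun n ↦ ((p n + ⌈n * u⌉₊ : ℕ) : ℝ) / n) atTop (𝓝 (x + u)) := by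
  have h := (tendsto_nat_ceil_mul_div_atTop hu).comp tendsto_natCast_atTop_atTop
  refine (hp.add h).congr fun n ↦ ?_
  simp only [Function.comp_apply]
  push_cast
  rw [add_div, mul_comm u]

/-- The summation operator of `chainWeight`, with weight `temperedPower`, converges after scaling to
the integral operator with kernel `c exp (-lam u) u ^ (α - 1)`. As `⌈n u⌉ / n ≥ u` and `α ≤ 1`, this
kernel dominates the step functions, up to a constant. -/
lemma tendsto_scaled_sum {α c lam : ℝ} (hα0 : 0 < α) (hα1 : α ≤ 1) (hc0 : 0 ≤ c)
    {U : ℕ → ℕ → ℝ} {V : ℝ → ℝ} {M : ℝ} (hM : 0 ≤ M) (hU : ∀ n q, 0 < n → |U n q| ≤ M)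
    (hUV : ∀ (q : ℕ → ℕ) (x : ℝ), 0 ≤ x → Tendsto (fun n ↦ (q n : ℝ) / n) atTop (𝓝 x) →
      Tendsto (fun n ↦ U n (q n)) atTop (𝓝 (V x)))
    {a b : ℝ} (ha : 0 ≤ a) (hb : 0 ≤ b) :
    (∃ M', 0 ≤ M' ∧ ∀ n p : ℕ, 0 < n → |(∑ q ∈ Finset.Ioc (max ⌊n * a⌋₊ p) ⌊n * b⌋₊,
      temperedPower α c lam n (q - p) * U n q) / (n : ℝ) ^ α| ≤ M') ∧
    ∀ (p : ℕ → ℕ) (x : ℝ), 0 ≤ x → Tendsto (fun n ↦ (p n : ℝ) / n) atTop (𝓝 x) →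
      Tendsto (fun n : ℕ ↦ (∑ q ∈ Finset.Ioc (max ⌊n * a⌋₊ (p n)) ⌊n * b⌋₊,
        temperedPower α c lam n (q - p n) * U n q) / (n : ℝ) ^ α) atTop
        (𝓝 (∫ y in Set.Ioc (max a x) b,
          c * Real.exp (-lam * (y - x)) * (y - x) ^ (α - 1) * V y)) := by
  set C : ℝ := c * Real.exp (|lam| * (b + 1)) * M with hC
  set κ : ℝ → ℝ := fun u ↦ c * Real.exp (-lam * u) * u ^ (α - 1) with hκ
  set F : ℕ → ℕ → ℝ → ℝ := fun n p u ↦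
    if ⌊n * a⌋₊ < p + ⌈n * u⌉₊ ∧ p + ⌈n * u⌉₊ ≤ ⌊n * b⌋₊ then
      κ (⌈n * u⌉₊ / n) * U n (p + ⌈n * u⌉₊) else 0 with hF
  have hrep : ∀ n p : ℕ, 0 < n → (∑ q ∈ Finset.Ioc (max ⌊n * a⌋₊ p) ⌊n * b⌋₊,
      temperedPower α c lam n (q - p) * U n q) / (n : ℝ) ^ α = ∫ u in Set.Ioc 0 b, F n p u := by
    intro n p hn
    have hn' : (n : ℝ) ≠ 0 := by positivity
    have h := sum_Ioc_max_eq_setIntegral (fun r ↦ temperedPower α c lam n r / (n : ℝ) ^ α * n)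
      (U n) hn ⌊n * a⌋₊ ⌊n * b⌋₊ p (Nat.floor_le (by positivity : 0 ≤ n * b))
    simp_rw [rpow_mul_temperedPower α c lam hn] at h
    rw [hF]
    simp only [hκ]
    rw [← h, Finset.sum_div, Finset.sum_div]
    refine Finset.sum_congr rfl fun q _ ↦ ?_
    rw [← rpow_mul_temperedPower α c lam hn]
    field_simp
  have hbound : ∀ n p : ℕ, 0 < n → ∀ u ∈ Set.Ioc 0 b, ‖F n p u‖ ≤ C * u ^ (α - 1) := by
    intro n p hn u hu
    have hn' : (0 : ℝ) < n := by exact_mod_cast hn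
    have hu0 : 0 < u := hu.1
    have hpos : 0 ≤ C * u ^ (α - 1) := by positivity
    simp only [hF]
    split_ifs
    · have h1 : u ≤ ⌈n * u⌉₊ / n := by
        rw [le_div_iff₀ hn', mul_comm]; exact Nat.le_ceil _
      have h2 : (⌈n * u⌉₊ / n : ℝ) ≤ b + 1 := by
        rw [div_le_iff₀ hn']
        have h3 := (Nat.ceil_lt_add_one (by positivity : 0 ≤ n * u)).le
        have h4 : n * u ≤ n * b := by gcongr; exact hu.2
        have h5 : (1 : ℝ) ≤ n := by exact_mod_cast hn
        nlinarith
      have hexp : Real.exp (-lam * (⌈n * u⌉₊ / n)) ≤ Real.exp (|lam| * (b + 1)) := by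
        refine Real.exp_le_exp.2 ?_
        calc -lam * (⌈n * u⌉₊ / n) ≤ |lam| * (⌈n * u⌉₊ / n) := by
              gcongr; exact neg_le_abs lam
          _ ≤ _ := by gcongr
      have hpow : (⌈n * u⌉₊ / n : ℝ) ^ (α - 1) ≤ u ^ (α - 1) :=
        Real.rpow_le_rpow_of_nonpos hu0 h1 (by linarith)
      rw [norm_mul, Real.norm_eq_abs, Real.norm_eq_abs, hC]
      have hκ0 : 0 ≤ κ (⌈n * u⌉₊ / n) := by simp only [hκ]; positivity
      rw [abs_of_nonneg hκ0]
      calc κ (⌈n * u⌉₊ / n) * |U n (p + ⌈n * u⌉₊)|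
          ≤ (c * Real.exp (|lam| * (b + 1)) * u ^ (α - 1)) * M := by
            simp only [hκ]
            gcongr
            exact hU n _ hn
        _ = _ := by ring
    · simpa using hpos
  have hint : IntegrableOn (fun u : ℝ ↦ C * u ^ (α - 1)) (Set.Ioc 0 b) := by
    have := intervalIntegral.intervalIntegrable_rpow' (a := 0) (b := b)
      (by linarith : -1 < α - 1)
    exact ((intervalIntegrable_iff_integrableOn_Ioc_of_le hb).1 this).const_mul C
  refine ⟨⟨∫ u in Set.Ioc 0 b, C * u ^ (α - 1), ?_, fun n p hn ↦ ?_⟩, fun p x hx hp ↦ ?_⟩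
  · refine setIntegral_nonneg measurableSet_Ioc fun u hu ↦ ?_
    have := hu.1
    positivity
  · rw [hrep n p hn, ← Real.norm_eq_abs]
    refine norm_integral_le_of_norm_le hint ?_
    exact (ae_restrict_iff' measurableSet_Ioc).2 (ae_of_all _ (hbound n p hn))
  · set L : ℝ → ℝ := fun u ↦ if a < x + u ∧ x + u ≤ b then κ u * V (x + u) else 0 with hL
    have hlim : ∫ y in Set.Ioc (max a x) b,
        c * Real.exp (-lam * (y - x)) * (y - x) ^ (α - 1) * V y = ∫ u in Set.Ioc 0 b, L u := by
      rw [← integral_indicator measurableSet_Ioc, ← integral_indicator measurableSet_Ioc,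
        ← integral_add_left_eq_self _ x]
      refine integral_congr_ae (ae_of_all _ fun u ↦ ?_)
      simp only [Set.indicator_apply, Set.mem_Ioc, max_lt_iff, hL, add_sub_cancel_left]
      by_cases h : a < x + u ∧ x + u ≤ b
      · by_cases hu : 0 < u
        · rw [if_pos ⟨⟨h.1, by linarith⟩, h.2⟩, if_pos ⟨hu, by linarith [h.2]⟩, if_pos h]
        · rw [if_neg (fun h' ↦ hu (by linarith [h'.1.2])), if_neg (fun h' ↦ hu h'.1)]
      · rw [if_neg (fun h' ↦ h ⟨h'.1.1, h'.2⟩), if_neg h, ite_self]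
    rw [hlim]
    refine Tendsto.congr' (f₁ := fun n ↦ ∫ u in Set.Ioc 0 b, F n (p n) u) ?_ ?_
    · filter_upwards [eventually_gt_atTop 0] with n hn using (hrep n (p n) hn).symm
    refine tendsto_integral_filter_of_dominated_convergence (fun u ↦ C * u ^ (α - 1)) ?_ ?_ hint ?_
    · refine Eventually.of_forall fun n ↦ Measurable.aestronglyMeasurable ?_
      exact (measurable_from_nat (f := fun r ↦ if ⌊n * a⌋₊ < p n + r ∧ p n + r ≤ ⌊n * b⌋₊ then
        κ (r / n) * U n (p n + r) else 0)).comp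
        (Nat.measurable_ceil.comp (measurable_const_mul (n : ℝ)))
    · filter_upwards [eventually_gt_atTop 0] with n hn
      exact (ae_restrict_iff' measurableSet_Ioc).2 (ae_of_all _ (hbound n (p n) hn))
    · rw [ae_restrict_iff' measurableSet_Ioc]
      have hna : ∀ᵐ u : ℝ, u ≠ a - x := by simp [ae_iff]
      have hnb : ∀ᵐ u : ℝ, u ≠ b - x := by simp [ae_iff]
      filter_upwards [hna, hnb] with u hua hub hu
      have hq := tendsto_add_ceil_div hp hu.1.le
      have hpos : ∀ᶠ n : ℕ in atTop, (0 : ℝ) < n :=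
        (eventually_gt_atTop 0).mono fun n hn ↦ by exact_mod_cast hn
      by_cases h : a < x + u ∧ x + u ≤ b
      · have hub' : x + u < b := lt_of_le_of_ne h.2 fun h' ↦ hub (by linarith)
        simp only [hL, if_pos h]
        have hev : ∀ᶠ n : ℕ in atTop, κ (⌈n * u⌉₊ / n) * U n (p n + ⌈n * u⌉₊) = F n (p n) u := by
          filter_upwards [hq.eventually_const_lt h.1, hq.eventually_lt_const hub', hpos]
            with n h1 h2 hn
          rw [lt_div_iff₀ hn] at h1
          rw [div_lt_iff₀ hn] at h2
          have h3 : ⌊n * a⌋₊ < p n + ⌈n * u⌉₊ := by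
            rw [Nat.floor_lt (by positivity)]; linarith
          have h4 : p n + ⌈n * u⌉₊ ≤ ⌊n * b⌋₊ := by
            rw [Nat.le_floor_iff (by positivity)]; linarith
          exact (if_pos ⟨h3, h4⟩).symm
        refine Tendsto.congr' hev (Tendsto.mul ?_ (hUV _ _ (by linarith [hu.1]) hq))
        have hc' : ContinuousAt κ u := by
          have := hu.1.ne'
          simp only [hκ]
          exact (continuousAt_const.mul (by fun_prop)).mul
            (Real.continuousAt_rpow_const _ _ (Or.inl this))
        refine hc'.tendsto.comp ?_
        simpa [zero_add] using tendsto_add_ceil_div (p := fun _ ↦ 0) (x := 0) (by simp) hu.1.le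
      · simp only [hL, if_neg h]
        refine tendsto_const_nhds.congr' ?_
        rcases not_and_or.1 h with h | h
        · have : x + u < a := lt_of_le_of_ne (not_lt.1 h) fun h' ↦ hua (by linarith)
          filter_upwards [hq.eventually_lt_const this, hpos] with n h1 hn
          rw [div_lt_iff₀ hn] at h1
          simp only [hF]
          rw [if_neg]
          rintro ⟨h2, -⟩
          rw [Nat.floor_lt (by positivity)] at h2
          linarith
        · filter_upwards [hq.eventually_const_lt (not_le.1 h), hpos] with n h1 hn
          rw [lt_div_iff₀ hn] at h1
          simp only [hF]
          rw [if_neg]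
          rintro ⟨-, h2⟩
          rw [Nat.le_floor_iff (by positivity)] at h2
          linarith

/-- The iterated integral `∫ c (y₁ - x)^(α-1) ∫ c (y₂ - y₁)^(α-1) ⋯ h (y_r)` over the increasing
chains `x < y₁ < ⋯ < y_r` with `y_j` in the `j`-th interval `(a_j, b_j]` of the list. The
exponential tempering is left out, as it telescopes and can be put into the terminal function
`h`. -/
noncomputable def chainPotential (α c : ℝ) (h : ℝ → ℝ) : List (ℝ × ℝ) → ℝ → ℝ
  | [], x => h x
  | J :: l, x => ∫ y in Set.Ioc (max J.1 x) J.2,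
      c * (y - x) ^ (α - 1) * chainPotential α c h l y

/-- The endpoints of the intervals in units of `1 / n`, rounded down. -/
noncomputable def latticeIntervals (n : ℕ) (l : List (ℝ × ℝ)) : List (ℕ × ℕ) :=
  l.map fun J ↦ (⌊(n : ℝ) * J.1⌋₊, ⌊(n : ℝ) * J.2⌋₊)

lemma chainWeight_scaling {α c lam : ℝ} (hα0 : 0 < α) (hα1 : α ≤ 1) (hc0 : 0 ≤ c)
    (l : List (ℝ × ℝ)) (hl : ∀ J ∈ l, 0 ≤ J.1 ∧ 0 ≤ J.2) :
    (∃ M, 0 ≤ M ∧ ∀ n q : ℕ, 0 < n →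
      |chainWeight (temperedPower α c lam n) (latticeIntervals n l) q /
        ((n : ℝ) ^ α) ^ l.length| ≤ M) ∧
    ∀ (q : ℕ → ℕ) (x : ℝ), 0 ≤ x → Tendsto (fun n ↦ (q n : ℝ) / n) atTop (𝓝 x) →
      Tendsto (fun n : ℕ ↦ chainWeight (temperedPower α c lam n) (latticeIntervals n l) (q n) /
        ((n : ℝ) ^ α) ^ l.length) atTop
        (𝓝 (Real.exp (lam * x) * chainPotential α c (fun y ↦ Real.exp (-lam * y)) l x)) := by
  induction l with
  | nil =>
    refine ⟨⟨1, zero_le_one, fun n q _ ↦ by simp [chainWeight, latticeIntervals]⟩,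
      fun q x _ _ ↦ ?_⟩
    rw [chainPotential, ← Real.exp_add]
    simp [chainWeight, latticeIntervals]
  | cons J l ih =>
    obtain ⟨⟨M, hM0, hM⟩, hlim⟩ := ih fun J' hJ' ↦ hl J' (by simp [hJ'])
    have hJ := hl J (by simp)
    obtain ⟨⟨M', hM0', hM'⟩, hlim'⟩ :=
      tendsto_scaled_sum (lam := lam) hα0 hα1 hc0 hM0 hM hlim hJ.1 hJ.2
    have heq : ∀ n p : ℕ, chainWeight (temperedPower α c lam n) (latticeIntervals n (J :: l)) p /
        ((n : ℝ) ^ α) ^ (J :: l).length = (∑ q ∈ Finset.Ioc (max ⌊n * J.1⌋₊ p) ⌊n * J.2⌋₊,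
          temperedPower α c lam n (q - p) *
            (chainWeight (temperedPower α c lam n) (latticeIntervals n l) q /
              ((n : ℝ) ^ α) ^ l.length)) / (n : ℝ) ^ α := by
      intro n p
      rw [latticeIntervals, List.map_cons, chainWeight, ← latticeIntervals, List.length_cons,
        pow_succ, ← div_div, Finset.sum_div]
      simp_rw [mul_div_assoc]
    refine ⟨⟨M', hM0', fun n q hn ↦ by rw [heq]; exact hM' n q hn⟩, fun q x hx hq ↦ ?_⟩
    simp_rw [heq]
    convert hlim' q x hx hq using 2
    rw [chainPotential, ← integral_const_mul]
    refine integral_congr_ae (ae_of_all _ fun y ↦ ?_)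
    simp only
    rw [show lam * x = -lam * (y - x) + lam * y by ring, Real.exp_add]
    ring

/-! ### Beta integrals and iterated fractional integrals -/

lemma beta_integrand_zero_one {p q : ℝ} (hp : 0 < p) (hq : 0 < q) :
    IntervalIntegrable (fun y : ℝ ↦ y ^ (p - 1) * (1 - y) ^ (q - 1)) volume 0 1 ∧
    ∫ y in (0 : ℝ)..1, y ^ (p - 1) * (1 - y) ^ (q - 1) =
      Real.Gamma p * Real.Gamma q / Real.Gamma (p + q) := by
  have hconv := Complex.betaIntegral_convergent (u := p) (v := q) (by simpa) (by simpa)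
  have heq : Set.EqOn (fun y : ℝ ↦ (y : ℂ) ^ ((p : ℂ) - 1) * (1 - (y : ℂ)) ^ ((q : ℂ) - 1))
      (fun y ↦ ((y ^ (p - 1) * (1 - y) ^ (q - 1) : ℝ) : ℂ)) (Set.uIcc 0 1) := by
    intro y hy
    rw [Set.uIcc_of_le zero_le_one] at hy
    have h1 : (0 : ℝ) ≤ 1 - y := by linarith [hy.2]
    simp only
    push_cast [Complex.ofReal_cpow hy.1, Complex.ofReal_cpow h1]
    rfl
  have hconv' := hconv.congr (fun y hy ↦ heq (Set.uIoc_subset_uIcc hy))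
  refine ⟨?_, ?_⟩
  · rw [intervalIntegrable_iff] at hconv' ⊢
    have := Integrable.re hconv'
    simp only [RCLike.re_to_complex, Complex.ofReal_re] at this
    rw [Set.uIoc_of_le zero_le_one] at this ⊢
    exact this
  · have h := Complex.betaIntegral_eq_Gamma_mul_div (p : ℂ) q (by simpa) (by simpa)
    rw [Complex.betaIntegral, intervalIntegral.integral_congr heq,
      intervalIntegral.integral_ofReal, ← Complex.ofReal_add, Complex.Gamma_ofReal,
      Complex.Gamma_ofReal, Complex.Gamma_ofReal] at h
    exact_mod_cast h

lemma beta_integrand {p q : ℝ} (hp : 0 < p) (hq : 0 < q) {x b : ℝ} (hxb : x < b) :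
    IntegrableOn (fun y : ℝ ↦ (y - x) ^ (p - 1) * (b - y) ^ (q - 1)) (Set.Ioc x b) ∧
    ∫ y in Set.Ioc x b, (y - x) ^ (p - 1) * (b - y) ^ (q - 1) =
      (b - x) ^ (p + q - 1) * (Real.Gamma p * Real.Gamma q / Real.Gamma (p + q)) := by
  have hd : 0 < b - x := by linarith
  obtain ⟨hi, hv⟩ := beta_integrand_zero_one hp hq
  have heq : ∀ y ∈ Set.Ioc x b, (y - x) ^ (p - 1) * (b - y) ^ (q - 1) =
      (b - x) ^ (p + q - 2) * ((y / (b - x) - x / (b - x)) ^ (p - 1) *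
        (1 - (y / (b - x) - x / (b - x))) ^ (q - 1)) := by
    intro y hy
    have h1 : y / (b - x) - x / (b - x) = (y - x) / (b - x) := by ring
    have h2 : 1 - (y / (b - x) - x / (b - x)) = (b - y) / (b - x) := by field_simp; ring
    rw [h2, h1, Real.div_rpow (by linarith [hy.1]) hd.le, Real.div_rpow (by linarith [hy.2]) hd.le,
      show p + q - 2 = (p - 1) + (q - 1) by ring, Real.rpow_add hd]
    have := Real.rpow_pos_of_pos hd (p - 1)
    have := Real.rpow_pos_of_pos hd (q - 1)
    field_simp
  have e0 : x / (b - x) - x / (b - x) = 0 := sub_self _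
  have e1 : b / (b - x) - x / (b - x) = 1 := by field_simp
  constructor
  · rw [integrableOn_congr_fun heq measurableSet_Ioc,
      ← intervalIntegrable_iff_integrableOn_Ioc_of_le hxb.le]
    refine IntervalIntegrable.const_mul ?_ _
    have h3 := hi.comp_sub_right (x / (b - x))
    have h4 := h3.comp_mul_right (c := (b - x)⁻¹)
    convert h4 using 2
    all_goals field_simp
    all_goals ring
  · rw [setIntegral_congr_fun measurableSet_Ioc heq, integral_const_mul,
      ← intervalIntegral.integral_of_le hxb.le,
      intervalIntegral.integral_comp_div_sub
        (f := fun z ↦ z ^ (p - 1) * (1 - z) ^ (q - 1)) hd.ne', e0, e1, hv, smul_eq_mul, ← mul_assoc]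
    congr 1
    rw [show p + q - 1 = (p + q - 2) + 1 by ring, Real.rpow_add_one hd.ne']

lemma triangle_kernel_section (p q x b y : ℝ) :
    (fun z : ℝ ↦ if x < z ∧ z < y ∧ y ≤ b then (z - x) ^ (p - 1) * (y - z) ^ (q - 1) else 0) =
      if x < y ∧ y ≤ b then (Set.Ioo x y).indicator
        (fun z ↦ (z - x) ^ (p - 1) * (y - z) ^ (q - 1)) else 0 := by
  funext z
  by_cases h1 : x < z ∧ z < y
  · by_cases h2 : y ≤ b
    · rw [if_pos ⟨h1.1, h1.2, h2⟩, if_pos ⟨h1.1.trans h1.2, h2⟩,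
        Set.indicator_of_mem (show z ∈ Set.Ioo x y from h1)]
    · rw [if_neg (fun h ↦ h2 h.2.2), if_neg (fun h ↦ h2 h.2), Pi.zero_apply]
  · rw [if_neg (fun h ↦ h1 ⟨h.1, h.2.1⟩)]
    split_ifs
    · rw [Set.indicator_of_notMem (show z ∉ Set.Ioo x y from h1)]
    · rfl

lemma integral_triangle_kernel_section {p q : ℝ} (hp : 0 < p) (hq : 0 < q) (x b y : ℝ) :
    ∫ z, (if x < z ∧ z < y ∧ y ≤ b then (z - x) ^ (p - 1) * (y - z) ^ (q - 1) else 0) =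
      (Set.Ioc x b).indicator (fun y ↦ (y - x) ^ (p + q - 1) *
        (Real.Gamma p * Real.Gamma q / Real.Gamma (p + q))) y := by
  rw [triangle_kernel_section p q x b y]
  by_cases h : x < y ∧ y ≤ b
  · rw [if_pos h, Set.indicator_of_mem (show y ∈ Set.Ioc x b from h),
      integral_indicator measurableSet_Ioo, ← integral_Ioc_eq_integral_Ioo,
      (beta_integrand hp hq h.1).2]
  · rw [if_neg h, Set.indicator_of_notMem (show y ∉ Set.Ioc x b from h)]
    simp

/-- The kernel of a composition of two fractional integrals is integrable over a triangle. -/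
lemma integrable_triangle_kernel {p q : ℝ} (hp : 0 < p) (hq : 0 < q) (x b : ℝ) :
    Integrable (fun z : ℝ × ℝ ↦ if x < z.1 ∧ z.1 < z.2 ∧ z.2 ≤ b then
      (z.1 - x) ^ (p - 1) * (z.2 - z.1) ^ (q - 1) else 0) (volume.prod volume) := by
  have hmeas : Measurable (fun z : ℝ × ℝ ↦ if x < z.1 ∧ z.1 < z.2 ∧ z.2 ≤ b then
      (z.1 - x) ^ (p - 1) * (z.2 - z.1) ^ (q - 1) else 0) := by
    refine Measurable.ite ?_ (by fun_prop) measurable_const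
    exact (measurableSet_lt measurable_const measurable_fst).inter
      ((measurableSet_lt measurable_fst measurable_snd).inter
        (measurableSet_le measurable_snd measurable_const))
  rw [integrable_prod_iff' hmeas.aestronglyMeasurable]
  constructor
  · refine ae_of_all _ fun y ↦ ?_
    simp only
    rw [triangle_kernel_section p q x b y]
    split_ifs with h
    · rw [integrable_indicator_iff measurableSet_Ioo]
      exact (beta_integrand hp hq h.1).1.mono_set Set.Ioo_subset_Ioc_self
    · exact integrable_zero _ _ _
  · have hnn : ∀ y z, ‖if x < z ∧ z < y ∧ y ≤ b then
        (z - x) ^ (p - 1) * (y - z) ^ (q - 1) else 0‖ = if x < z ∧ z < y ∧ y ≤ b then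
        (z - x) ^ (p - 1) * (y - z) ^ (q - 1) else 0 := by
      intro y z
      rw [Real.norm_eq_abs, abs_of_nonneg]
      split_ifs with h
      · have h1 : 0 ≤ z - x := by linarith [h.1]
        have h2 : 0 ≤ y - z := by linarith [h.2.1]
        positivity
      · exact le_rfl
    simp_rw [hnn, integral_triangle_kernel_section hp hq x b]
    rw [integrable_indicator_iff measurableSet_Ioc]
    refine Integrable.mul_const ?_ _
    rcases le_or_gt b x with h | h
    · simp [Set.Ioc_eq_empty (not_lt.2 h)]
    · have := (beta_integrand (add_pos hp hq) one_pos h).1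
      refine this.congr (ae_of_all _ fun y ↦ ?_)
      simp

/-- Exchange of the order of integration in a composition of two fractional integrals. -/
lemma integral_swap_triangle {p q : ℝ} (hp : 0 < p) (hq : 0 < q) (x b : ℝ) {g : ℝ × ℝ → ℝ}
    (hg : Measurable g) {M : ℝ} (hM : ∀ z, |g z| ≤ M) :
    ∫ z, ∫ y, (if x < z ∧ z < y ∧ y ≤ b then
      (z - x) ^ (p - 1) * (y - z) ^ (q - 1) else 0) * g (z, y) =
    ∫ y, ∫ z, (if x < z ∧ z < y ∧ y ≤ b then
      (z - x) ^ (p - 1) * (y - z) ^ (q - 1) else 0) * g (z, y) := by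
  refine integral_integral_swap (f := fun z y ↦ (if x < z ∧ z < y ∧ y ≤ b then
      (z - x) ^ (p - 1) * (y - z) ^ (q - 1) else 0) * g (z, y)) ?_
  refine (integrable_triangle_kernel hp hq x b).mul_bdd (c := M) hg.aestronglyMeasurable ?_
  exact ae_of_all _ hM

lemma chainPotential_append (α c : ℝ) (h : ℝ → ℝ) (l₁ l₂ : List (ℝ × ℝ)) :
    chainPotential α c h (l₁ ++ l₂) = chainPotential α c (chainPotential α c h l₂) l₁ := by
  induction l₁ with
  | nil => funext x; simp [chainPotential]
  | cons J l ih => funext x; simp [chainPotential, ih]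

lemma measurable_chainPotential (α c : ℝ) {h : ℝ → ℝ} (hh : Measurable h) (l : List (ℝ × ℝ)) :
    Measurable (chainPotential α c h l) := by
  induction l with
  | nil => exact hh
  | cons J l ih =>
    have hrep : chainPotential α c h (J :: l) = fun x ↦ ∫ y, if max J.1 x < y ∧ y ≤ J.2 then
        c * (y - x) ^ (α - 1) * chainPotential α c h l y else 0 := by
      funext x
      rw [chainPotential, ← integral_indicator measurableSet_Ioc]
      simp only [Set.indicator_apply, Set.mem_Ioc]
    rw [hrep]
    refine (StronglyMeasurable.integral_prod_right (f := fun x y ↦ if max J.1 x < y ∧ y ≤ J.2 then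
        c * (y - x) ^ (α - 1) * chainPotential α c h l y else 0)
        (Measurable.stronglyMeasurable ?_)).measurable
    refine Measurable.ite ?_ (by fun_prop) measurable_const
    exact (measurableSet_lt (by fun_prop) measurable_snd).inter
      (measurableSet_le measurable_snd measurable_const)

/-- The iterates of the fractional integral with kernel `c u ^ (α - 1)` have the kernels
`(c Γ(α)) ^ k u ^ (k α - 1) / Γ(k α)`. -/
lemma chainPotential_replicate {α c : ℝ} (hα : 0 < α) {a b : ℝ} {h : ℝ → ℝ} (hh : Measurable h)
    {M : ℝ} (hM : ∀ y ∈ Set.Ioc a b, |h y| ≤ M) (k : ℕ) {x : ℝ} (hx : a ≤ x) :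
    chainPotential α c h (List.replicate (k + 1) (a, b)) x =
      (c * Real.Gamma α) ^ (k + 1) / Real.Gamma ((k + 1 : ℕ) * α) *
        ∫ y in Set.Ioc x b, (y - x) ^ ((k + 1 : ℕ) * α - 1) * h y := by
  have hΓ : Real.Gamma α ≠ 0 := (Real.Gamma_pos_of_pos hα).ne'
  induction k generalizing x with
  | zero =>
    simp only [zero_add, List.replicate_one, chainPotential, max_eq_right hx, pow_one,
      Nat.cast_one, one_mul]
    rw [mul_div_cancel_right₀ _ hΓ, ← integral_const_mul]
    simp_rw [mul_assoc]
  | succ k ih =>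
    have hkα : 0 < ((k + 1 : ℕ) : ℝ) * α := by positivity
    set C := (c * Real.Gamma α) ^ (k + 1) / Real.Gamma ((k + 1 : ℕ) * α) with hC
    set g : ℝ × ℝ → ℝ := fun z ↦ (Set.Ioc x b).indicator h z.2 with hg
    have hgm : Measurable g := (hh.indicator measurableSet_Ioc).comp measurable_snd
    have hgM : ∀ z, |g z| ≤ max M 0 := by
      intro z
      simp only [hg, Set.indicator_apply]
      split_ifs with hz
      · exact (hM z.2 ⟨hx.trans_lt hz.1, hz.2⟩).trans (le_max_left _ _)
      · simp
    have hswap := integral_swap_triangle hα hkα x b hgm hgM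
    have hleft : chainPotential α c h (List.replicate (k + 2) (a, b)) x = c * C *
        ∫ z, ∫ y, (if x < z ∧ z < y ∧ y ≤ b then
          (z - x) ^ (α - 1) * (y - z) ^ ((k + 1 : ℕ) * α - 1) else 0) * g (z, y) := by
      rw [List.replicate_succ, chainPotential, max_eq_right hx,
        ← integral_indicator measurableSet_Ioc, ← integral_const_mul]
      refine integral_congr_ae (ae_of_all _ fun z ↦ ?_)
      simp only [Set.indicator_apply]
      split_ifs with hz
      · rw [ih (hx.trans hz.1.le), ← integral_indicator measurableSet_Ioc, ← mul_assoc,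
          mul_right_comm c, mul_assoc (c * C), ← integral_const_mul]
        congr 1
        refine integral_congr_ae (ae_of_all _ fun y ↦ ?_)
        simp only [Set.indicator_apply, hg, Set.mem_Ioc]
        by_cases hy : z < y ∧ y ≤ b
        · rw [if_pos hy, if_pos ⟨hz.1, hy⟩, if_pos ⟨hz.1.trans hy.1, hy.2⟩]
          ring
        · rw [if_neg hy, if_neg (fun h' ↦ hy h'.2)]
          simp
      · symm
        rw [mul_eq_zero]
        right
        refine integral_eq_zero_of_ae (ae_of_all _ fun y ↦ ?_)
        simp only [Pi.zero_apply]
        rw [if_neg, zero_mul]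
        rintro ⟨h1, h2, h3⟩
        exact hz ⟨h1, by linarith⟩
    rw [hleft, hswap]
    have hright : ∀ y, ∫ z, (if x < z ∧ z < y ∧ y ≤ b then
          (z - x) ^ (α - 1) * (y - z) ^ ((k + 1 : ℕ) * α - 1) else 0) * g (z, y) =
        (Set.Ioc x b).indicator (fun y ↦ (Real.Gamma α * Real.Gamma ((k + 1 : ℕ) * α) /
          Real.Gamma (α + (k + 1 : ℕ) * α)) * ((y - x) ^ ((k + 2 : ℕ) * α - 1) * h y)) y := by
      intro y
      simp only [hg]
      rw [integral_mul_const, integral_triangle_kernel_section hα hkα]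
      simp only [Set.indicator_apply]
      split_ifs with hy
      · rw [show α + (k + 1 : ℕ) * α - 1 = (k + 2 : ℕ) * α - 1 by push_cast; ring]
        ring
      · simp
    simp_rw [hright]
    rw [integral_indicator measurableSet_Ioc, integral_const_mul, ← mul_assoc]
    congr 1
    have hΓk := (Real.Gamma_pos_of_pos hkα).ne'
    rw [hC, show α + (k + 1 : ℕ) * α = (k + 1 + 1 : ℕ) * α by push_cast; ring]
    field_simp
    ring

/-! ### Chain potentials of short blocks -/

lemma integrableOn_sub_rpow {x b r : ℝ} (hr : -1 < r) (hxb : x ≤ b) :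
    IntegrableOn (fun y : ℝ ↦ (y - x) ^ r) (Set.Ioc x b) := by
  rw [← intervalIntegrable_iff_integrableOn_Ioc_of_le hxb]
  have := (intervalIntegral.intervalIntegrable_rpow' (a := 0) (b := b - x) hr).comp_sub_right x
  simpa using this

lemma integral_sub_rpow {x b r : ℝ} (hr : -1 < r) (hxb : x ≤ b) :
    ∫ y in Set.Ioc x b, (y - x) ^ r = (b - x) ^ (r + 1) / (r + 1) := by
  rw [← intervalIntegral.integral_of_le hxb,
    intervalIntegral.integral_comp_sub_right (fun z ↦ z ^ r), sub_self,
    integral_rpow (Or.inl hr), Real.zero_rpow (by linarith), sub_zero]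

lemma integral_rpow_sub {x b r : ℝ} (hr : -1 < r) (hxb : x ≤ b) :
    ∫ y in Set.Ioc x b, (b - y) ^ r = (b - x) ^ (r + 1) / (r + 1) := by
  rw [← intervalIntegral.integral_of_le hxb,
    intervalIntegral.integral_comp_sub_left (fun z ↦ z ^ r), sub_self,
    integral_rpow (Or.inl hr), Real.zero_rpow (by linarith), sub_zero]

/-- Bounds for the potential of `k` points in the interval `(a, b]`, which are sharp for a constant
terminal function. -/
lemma chainPotential_replicate_bounds {α c : ℝ} (hα : 0 < α) (hc : 0 ≤ c) {a b : ℝ} {h : ℝ → ℝ}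
    (hh : Measurable h) {e₁ e₂ : ℝ} (he : 0 ≤ e₁)
    (hle : ∀ y ∈ Set.Ioc a b, e₁ ≤ h y ∧ h y ≤ e₂) (k : ℕ) {x : ℝ} (hx : x ∈ Set.Ioc a b) :
    e₁ * ((c * Real.Gamma α) ^ k / Real.Gamma (k * α + 1) * (b - x) ^ (k * α)) ≤
        chainPotential α c h (List.replicate k (a, b)) x ∧
      chainPotential α c h (List.replicate k (a, b)) x ≤
        e₂ * ((c * Real.Gamma α) ^ k / Real.Gamma (k * α + 1) * (b - x) ^ (k * α)) := by
  cases k with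
  | zero => simpa [chainPotential] using hle x hx
  | succ k =>
    have hkα : 0 < ((k + 1 : ℕ) : ℝ) * α := by positivity
    have hM : ∀ y ∈ Set.Ioc a b, |h y| ≤ e₂ := fun y hy ↦ by
      rw [abs_of_nonneg (he.trans (hle y hy).1)]; exact (hle y hy).2
    have hsub : Set.Ioc x b ⊆ Set.Ioc a b := Set.Ioc_subset_Ioc_left hx.1.le
    have hint := integrableOn_sub_rpow (x := x) (b := b)
      (by linarith : -1 < ((k + 1 : ℕ) : ℝ) * α - 1) hx.2
    have hint' : IntegrableOn (fun y ↦ (y - x) ^ ((k + 1 : ℕ) * α - 1) * h y) (Set.Ioc x b) :=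
      hint.mul_bdd (c := e₂) hh.aestronglyMeasurable.restrict
        ((ae_restrict_iff' measurableSet_Ioc).2 (ae_of_all _ fun y hy ↦ hM y (hsub hy)))
    have hval := integral_sub_rpow (x := x) (b := b)
      (by linarith : -1 < ((k + 1 : ℕ) : ℝ) * α - 1) hx.2
    rw [sub_add_cancel] at hval
    have hpos : 0 ≤ (c * Real.Gamma α) ^ (k + 1) / Real.Gamma ((k + 1 : ℕ) * α) := by
      have := Real.Gamma_pos_of_pos hα
      have := Real.Gamma_pos_of_pos hkα
      positivity
    have hform : ∀ e : ℝ, e * ((c * Real.Gamma α) ^ (k + 1) / Real.Gamma ((k + 1 : ℕ) * α + 1) *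
        (b - x) ^ ((k + 1 : ℕ) * α)) =
        (c * Real.Gamma α) ^ (k + 1) / Real.Gamma ((k + 1 : ℕ) * α) *
          ∫ y in Set.Ioc x b, (y - x) ^ ((k + 1 : ℕ) * α - 1) * e := by
      intro e
      have := (Real.Gamma_pos_of_pos hkα).ne'
      rw [integral_mul_const, hval, Real.Gamma_add_one hkα.ne']
      field_simp
    rw [chainPotential_replicate hα hh hM k hx.1.le, hform e₁, hform e₂]
    constructor
    · refine mul_le_mul_of_nonneg_left ?_ hpos
      refine setIntegral_mono_on (hint.mul_const e₁) hint' measurableSet_Ioc fun y hy ↦ ?_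
      have : 0 ≤ y - x := by linarith [hy.1]
      exact mul_le_mul_of_nonneg_left (hle y (hsub hy)).1 (by positivity)
    · refine mul_le_mul_of_nonneg_left ?_ hpos
      refine setIntegral_mono_on hint' (hint.mul_const e₂) measurableSet_Ioc fun y hy ↦ ?_
      have : 0 ≤ y - x := by linarith [hy.1]
      exact mul_le_mul_of_nonneg_left (hle y (hsub hy)).2 (by positivity)

/-- The integral over `a < y₁ < ⋯ < y_{k+1} ≤ a + d` of `∏ c (y_{j+1} - y_j) ^ (α - 1)`. -/
noncomputable def blockMass (α c : ℝ) (k : ℕ) (d : ℝ) : ℝ :=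
  (c * Real.Gamma α) ^ k / Real.Gamma (k * α + 2) * d ^ (k * α + 1)

lemma blockMass_pos {α c : ℝ} (hα : 0 < α) (hc : 0 < c) (k : ℕ) {d : ℝ} (hd : 0 < d) :
    0 < blockMass α c k d := by
  have := Real.Gamma_pos_of_pos hα
  have := Real.Gamma_pos_of_pos (by positivity : 0 < k * α + 2)
  unfold blockMass
  positivity

/-- Bounds for the integral of a potential over a short block, against a weight that varies little
there. The weight is the kernel from a preceding point, or `exp (lam * y)` for a first point with a
uniform density. -/
lemma integral_weight_mul_chainPotential_bounds {α c : ℝ} (hα : 0 < α) (hc : 0 < c) {b d : ℝ}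
    (hd : 0 < d) {h w : ℝ → ℝ} (hh : Measurable h) (hw : Measurable w) {e₁ e₂ w₁ w₂ : ℝ}
    (he : 0 ≤ e₁) (hle : ∀ y ∈ Set.Ioc (b - d) b, e₁ ≤ h y ∧ h y ≤ e₂)
    (hw0 : 0 ≤ w₁) (hwle : ∀ y ∈ Set.Ioc (b - d) b, w₁ ≤ w y ∧ w y ≤ w₂) (k : ℕ) :
    w₁ * blockMass α c k d * e₁ ≤
        ∫ y in Set.Ioc (b - d) b, w y * chainPotential α c h (List.replicate k (b - d, b)) y ∧
      ∫ y in Set.Ioc (b - d) b, w y * chainPotential α c h (List.replicate k (b - d, b)) y ≤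
        w₂ * blockMass α c k d * e₂ := by
  set Φ := chainPotential α c h (List.replicate k (b - d, b)) with hΦ
  have hΦm : Measurable Φ := measurable_chainPotential α c hh _
  have hΦle := fun y hy ↦ chainPotential_replicate_bounds hα hc.le hh he hle k (x := y) hy
  set C := (c * Real.Gamma α) ^ k / Real.Gamma (k * α + 1) with hC
  have hkα : 0 < k * α + 1 := by positivity
  have hC0 : 0 < C := by
    have := Real.Gamma_pos_of_pos hα
    have := Real.Gamma_pos_of_pos hkα
    positivity
  have hcont : Continuous fun y ↦ C * (b - y) ^ (k * α) :=
    continuous_const.mul ((continuous_const.sub continuous_id).rpow_const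
      fun y ↦ Or.inr (by positivity))
  have hint : IntegrableOn (fun y ↦ C * (b - y) ^ (k * α)) (Set.Ioc (b - d) b) :=
    (hcont.integrableOn_Icc).mono_set Set.Ioc_subset_Icc_self
  have hval : ∫ y in Set.Ioc (b - d) b, C * (b - y) ^ (k * α) = blockMass α c k d := by
    rw [integral_const_mul, integral_rpow_sub (by linarith) (by linarith), sub_sub_cancel, hC,
      blockMass, show k * α + 2 = (k * α + 1) + 1 by ring, Real.Gamma_add_one hkα.ne']
    have := (Real.Gamma_pos_of_pos hkα).ne'
    field_simp
  have hnn : ∀ y ∈ Set.Ioc (b - d) b, 0 ≤ C * (b - y) ^ (k * α) := fun y hy ↦ by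
    have : 0 ≤ b - y := by linarith [hy.2]
    positivity
  have hlow : ∀ y ∈ Set.Ioc (b - d) b, w₁ * e₁ * (C * (b - y) ^ (k * α)) ≤ w y * Φ y := by
    intro y hy
    have h1 := hnn y hy
    have h2 : 0 ≤ e₁ * (C * (b - y) ^ (k * α)) := mul_nonneg he h1
    calc _ = w₁ * (e₁ * (C * (b - y) ^ (k * α))) := by ring
      _ ≤ w y * Φ y := mul_le_mul (hwle y hy).1 (hΦle y hy).1 h2 (hw0.trans (hwle y hy).1)
  have hupp : ∀ y ∈ Set.Ioc (b - d) b, w y * Φ y ≤ w₂ * e₂ * (C * (b - y) ^ (k * α)) := by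
    intro y hy
    have h1 := hnn y hy
    have h2 : 0 ≤ e₁ * (C * (b - y) ^ (k * α)) := mul_nonneg he h1
    calc w y * Φ y ≤ w₂ * (e₂ * (C * (b - y) ^ (k * α))) :=
          mul_le_mul (hwle y hy).2 (hΦle y hy).2 (h2.trans (hΦle y hy).1)
            (hw0.trans ((hwle y hy).1.trans (hwle y hy).2))
      _ = _ := by ring
  have hint' : IntegrableOn (fun y ↦ w y * Φ y) (Set.Ioc (b - d) b) := by
    refine Integrable.mono' (hint.const_mul (w₂ * e₂)) (hw.mul hΦm).aestronglyMeasurable.restrict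
      ((ae_restrict_iff' measurableSet_Ioc).2 (ae_of_all _ fun y hy ↦ ?_))
    rw [Real.norm_eq_abs, abs_of_nonneg]
    · exact hupp y hy
    · exact (mul_nonneg (mul_nonneg hw0 he) (hnn y hy)).trans (hlow y hy)
  constructor
  · have := setIntegral_mono_on (hint.const_mul (w₁ * e₁)) hint' measurableSet_Ioc hlow
    rw [integral_const_mul, hval] at this
    linarith
  · have := setIntegral_mono_on hint' (hint.const_mul (w₂ * e₂)) measurableSet_Ioc hupp
    rw [integral_const_mul, hval] at this
    linarith

lemma chainPotential_block_bounds {α c : ℝ} (hα : 0 < α) (hα1 : α ≤ 1) (hc : 0 < c) {b d Δ : ℝ}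
    (hd : 0 < d) (hΔ : d < Δ) {h : ℝ → ℝ} (hh : Measurable h) {e₁ e₂ : ℝ}
    (he : 0 ≤ e₁) (hle : ∀ y ∈ Set.Ioc (b - d) b, e₁ ≤ h y ∧ h y ≤ e₂) (k : ℕ) {x : ℝ}
    (hx : x ∈ Set.Icc (b - Δ - d) (b - Δ)) :
    c * (Δ + d) ^ (α - 1) * blockMass α c k d * e₁ ≤
        chainPotential α c h (List.replicate (k + 1) (b - d, b)) x ∧
      chainPotential α c h (List.replicate (k + 1) (b - d, b)) x ≤
        c * (Δ - d) ^ (α - 1) * blockMass α c k d * e₂ := by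
  rw [List.replicate_succ, chainPotential]
  simp only
  rw [max_eq_left (by linarith [hx.2])]
  refine integral_weight_mul_chainPotential_bounds hα hc hd hh (by fun_prop) he hle
    (mul_nonneg hc.le (Real.rpow_nonneg (by linarith) _)) (fun y hy ↦ ⟨?_, ?_⟩) k
  · refine mul_le_mul_of_nonneg_left (Real.rpow_le_rpow_of_nonpos ?_ ?_ (by linarith)) hc.le
    · linarith [hx.2, hy.1]
    · linarith [hx.1, hy.2]
  · refine mul_le_mul_of_nonneg_left (Real.rpow_le_rpow_of_nonpos ?_ ?_ (by linarith)) hc.le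
    · linarith
    · linarith [hx.2, hy.1]

/-- The potential of several short blocks `(t i - d, t i]` factorizes, up to the variation of the
kernel between two blocks. -/
lemma chainPotential_blockList_bounds {α c : ℝ} (hα : 0 < α) (hα1 : α ≤ 1) (hc : 0 < c) {d : ℝ}
    (hd : 0 < d) {h : ℝ → ℝ} (hh : Measurable h) {e₁ e₂ : ℝ} (he : 0 ≤ e₁) {m : ℕ}
    (t : Fin (m + 1) → ℝ) (ht : ∀ i : Fin m, d < t i.succ - t i.castSucc) (k : Fin m → ℕ)
    (hle : ∀ y ∈ Set.Icc (t (Fin.last m) - d) (t (Fin.last m)), e₁ ≤ h y ∧ h y ≤ e₂) {x : ℝ}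
    (hx : x ∈ Set.Icc (t 0 - d) (t 0)) :
    (∏ i : Fin m, c * (t i.succ - t i.castSucc + d) ^ (α - 1) * blockMass α c (k i) d) * e₁ ≤
        chainPotential α c h (blockList (fun i ↦ k i + 1) fun i ↦ (t i.succ - d, t i.succ)) x ∧
      chainPotential α c h (blockList (fun i ↦ k i + 1) fun i ↦ (t i.succ - d, t i.succ)) x ≤
        (∏ i : Fin m, c * (t i.succ - t i.castSucc - d) ^ (α - 1) * blockMass α c (k i) d) *
          e₂ := by
  induction m generalizing x with
  | zero => simpa [blockList, chainPotential] using hle x (by simpa using hx)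
  | succ m ih =>
    have ih' := fun y hy ↦ ih (fun i ↦ t i.succ) (fun i ↦ by simpa using ht i.succ)
      (fun i ↦ k i.succ) hle (x := y) hy
    rw [blockList_succ, chainPotential_append, Fin.prod_univ_succ, Fin.prod_univ_succ]
    have hlow : 0 ≤ (∏ i : Fin m, c * (t i.succ.succ - t i.succ.castSucc + d) ^ (α - 1) *
        blockMass α c (k i.succ) d) * e₁ := by
      refine mul_nonneg (Finset.prod_nonneg fun i _ ↦ ?_) he
      have := blockMass_pos hα hc (k i.succ) hd
      have h1 : 0 ≤ t i.succ.succ - t i.succ.castSucc + d := by linarith [ht i.succ]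
      positivity
    have := chainPotential_block_bounds hα hα1 hc (b := t (Fin.succ 0)) hd (ht 0)
      (measurable_chainPotential α c hh (blockList (fun i : Fin m ↦ k i.succ + 1)
        fun i ↦ (t i.succ.succ - d, t i.succ.succ))) hlow
      (fun y hy ↦ ih' y (Set.Ioc_subset_Icc_self hy)) (k 0) (x := x)
      (by
        rw [Fin.castSucc_zero]
        constructor <;> linarith [hx.1, hx.2])
    rw [mul_assoc _ _ e₁, mul_assoc _ _ e₂]
    exact this

/-! ### Asymptotics for short blocks -/

lemma tendsto_rpow_ratio {Δ r : ℝ} (hΔ : 0 < Δ) (σ : ℝ) :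
    Tendsto (fun d : ℝ ↦ (Δ + σ * d) ^ r / Δ ^ r) (𝓝[>] 0) (𝓝 1) := by
  have h1 : Tendsto (fun d : ℝ ↦ Δ + σ * d) (𝓝[>] 0) (𝓝 Δ) := by
    have : Tendsto (fun d : ℝ ↦ Δ + σ * d) (𝓝 0) (𝓝 (Δ + σ * 0)) :=
      (continuous_const.add (continuous_const.mul continuous_id)).tendsto 0
    rw [mul_zero, add_zero] at this
    exact this.mono_left nhdsWithin_le_nhds
  have h2 := (h1.rpow_const (p := r) (Or.inl hΔ.ne')).div_const (Δ ^ r)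
  rwa [div_self (Real.rpow_pos_of_pos hΔ r).ne'] at h2

lemma tendsto_exp_mul_nhdsGT_zero (σ : ℝ) :
    Tendsto (fun d : ℝ ↦ Real.exp (σ * d)) (𝓝[>] 0) (𝓝 1) := by
  have : Tendsto (fun d : ℝ ↦ Real.exp (σ * d)) (𝓝 0) (𝓝 (Real.exp (σ * 0))) :=
    (Real.continuous_exp.comp (continuous_const.mul continuous_id)).tendsto 0
  rw [mul_zero, Real.exp_zero] at this
  exact this.mono_left nhdsWithin_le_nhds

lemma exp_mul_bounds (lam : ℝ) {b d y : ℝ} (hy : y ∈ Set.Icc (b - d) b) :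
    Real.exp (lam * b) * Real.exp (-|lam| * d) ≤ Real.exp (lam * y) ∧
      Real.exp (lam * y) ≤ Real.exp (lam * b) * Real.exp (|lam| * d) := by
  have h0 : 0 ≤ b - y := by linarith [hy.2]
  have h1 : |lam| * (b - y) ≤ |lam| * d :=
    mul_le_mul_of_nonneg_left (by linarith [hy.1]) (abs_nonneg _)
  have h2 : lam * (b - y) ≤ |lam| * (b - y) := mul_le_mul_of_nonneg_right (le_abs_self _) h0
  have h3 : -lam * (b - y) ≤ |lam| * (b - y) := mul_le_mul_of_nonneg_right (neg_le_abs _) h0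
  rw [← Real.exp_add, ← Real.exp_add]
  constructor <;> refine Real.exp_le_exp.2 ?_ <;> linarith

lemma eventually_lt_gaps {m : ℕ} {t : Fin (m + 1) → ℝ} (ht : StrictMono t) :
    ∀ᶠ d : ℝ in 𝓝[>] 0, 0 < d ∧ ∀ i : Fin m, d < t i.succ - t i.castSucc := by
  refine (eventually_mem_nhdsWithin).and (eventually_all.2 fun i ↦ ?_)
  exact nhdsWithin_le_nhds (eventually_lt_nhds (sub_pos.2 (ht Fin.castSucc_lt_succ)))

/-- As the blocks shrink, their potential is asymptotic to the product of the masses of the single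
blocks and of the kernel at the gaps between them. -/
lemma chainPotential_blockList_isEquivalent {α c lam : ℝ} (hα : 0 < α) (hα1 : α ≤ 1) (hc : 0 < c)
    {m : ℕ} (t : Fin (m + 1) → ℝ) (ht : StrictMono t) (ht0 : t 0 = 0) (k : Fin m → ℕ) :
    (fun d ↦ chainPotential α c (fun y ↦ Real.exp (-lam * y))
        (blockList (fun i ↦ k i + 1) fun i ↦ (t i.succ - d, t i.succ)) 0) ~[𝓝[>] (0 : ℝ)]
      fun d ↦ (∏ i : Fin m, c * (t i.succ - t i.castSucc) ^ (α - 1) * blockMass α c (k i) d) *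
        Real.exp (-lam * t (Fin.last m)) := by
  have hΔ : ∀ i : Fin m, 0 < t i.succ - t i.castSucc := fun i ↦
    sub_pos.2 (ht Fin.castSucc_lt_succ)
  have hmain : ∀ σ τ : ℝ, Tendsto (fun d : ℝ ↦ (∏ i : Fin m,
      (t i.succ - t i.castSucc + σ * d) ^ (α - 1) / (t i.succ - t i.castSucc) ^ (α - 1)) *
        Real.exp (τ * d)) (𝓝[>] 0) (𝓝 1) := by
    intro σ τ
    have := (tendsto_finsetProd Finset.univ fun i _ ↦
      tendsto_rpow_ratio (r := α - 1) (hΔ i) σ).mul (tendsto_exp_mul_nhdsGT_zero τ)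
    simpa using this
  refine isEquivalent_of_tendsto_one ?_
  have hfac : ∀ d : ℝ, 0 < d → ∀ σ τ : ℝ,
      (∏ i : Fin m, c * (t i.succ - t i.castSucc + σ * d) ^ (α - 1) * blockMass α c (k i) d) *
        (Real.exp (-lam * t (Fin.last m)) * Real.exp (τ * d)) =
      ((∏ i : Fin m, (t i.succ - t i.castSucc + σ * d) ^ (α - 1) /
        (t i.succ - t i.castSucc) ^ (α - 1)) * Real.exp (τ * d)) *
      ((∏ i : Fin m, c * (t i.succ - t i.castSucc) ^ (α - 1) * blockMass α c (k i) d) *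
        Real.exp (-lam * t (Fin.last m))) := by
    intro d hd σ τ
    have : ∏ i : Fin m, c * (t i.succ - t i.castSucc + σ * d) ^ (α - 1) * blockMass α c (k i) d =
        (∏ i : Fin m, (t i.succ - t i.castSucc + σ * d) ^ (α - 1) /
          (t i.succ - t i.castSucc) ^ (α - 1)) *
        ∏ i : Fin m, c * (t i.succ - t i.castSucc) ^ (α - 1) * blockMass α c (k i) d := by
      rw [← Finset.prod_mul_distrib]
      refine Finset.prod_congr rfl fun i _ ↦ ?_
      have := (Real.rpow_pos_of_pos (hΔ i) (α - 1)).ne'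
      field_simp
    rw [this]
    ring
  have hbd : ∀ᶠ d : ℝ in 𝓝[>] 0, _ := (eventually_lt_gaps ht).mono fun d hd ↦ by
    have hb := chainPotential_blockList_bounds hα hα1 hc hd.1
      (h := fun y ↦ Real.exp (-lam * y)) (by fun_prop) (by positivity) t hd.2 k
      (fun y hy ↦ exp_mul_bounds (-lam) hy) (x := 0)
      (by rw [ht0]; exact ⟨by linarith [hd.1], le_rfl⟩)
    have h1 := hfac d hd.1 1 (-|-lam|)
    have h2 := hfac d hd.1 (-1) |-lam|
    simp only [one_mul, neg_one_mul, ← sub_eq_add_neg] at h1 h2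
    rw [h1, h2] at hb
    have hpos : 0 < (∏ i : Fin m, c * (t i.succ - t i.castSucc) ^ (α - 1) *
        blockMass α c (k i) d) * Real.exp (-lam * t (Fin.last m)) := by
      refine mul_pos (Finset.prod_pos fun i _ ↦ ?_) (Real.exp_pos _)
      have := blockMass_pos hα hc (k i) hd.1
      have := hΔ i
      positivity
    exact And.intro ((le_div_iff₀ hpos).2 hb.1) ((div_le_iff₀ hpos).2 hb.2)
  have hl := hmain 1 (-|-lam|)
  have hu := hmain (-1) |-lam|
  simp only [one_mul, neg_one_mul, ← sub_eq_add_neg] at hl hu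
  exact tendsto_of_tendsto_of_tendsto_of_le_of_le' hl hu (hbd.mono fun d h ↦ h.1)
    (hbd.mono fun d h ↦ h.2)

lemma integral_exp_mul_chainPotential_isEquivalent {α c lam : ℝ} (hα : 0 < α) (hc : 0 < c)
    (b : ℝ) (k : ℕ) :
    (fun d ↦ ∫ y in Set.Ioc (b - d) b, Real.exp (lam * y) *
        chainPotential α c (fun y ↦ Real.exp (-lam * y)) (List.replicate k (b - d, b)) y)
      ~[𝓝[>] (0 : ℝ)] fun d ↦ blockMass α c k d := by
  refine isEquivalent_of_tendsto_one ?_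
  have hbd : ∀ᶠ d : ℝ in 𝓝[>] 0, _ := (eventually_mem_nhdsWithin (a := (0 : ℝ))
      (s := Set.Ioi 0)).mono fun d (hd : 0 < d) ↦ by
    have hb := integral_weight_mul_chainPotential_bounds hα hc hd (b := b)
      (h := fun y ↦ Real.exp (-lam * y)) (w := fun y ↦ Real.exp (lam * y)) (by fun_prop)
      (by fun_prop) (by positivity)
      (fun y hy ↦ exp_mul_bounds (-lam) (Set.Ioc_subset_Icc_self hy)) (by positivity)
      (fun y hy ↦ exp_mul_bounds lam (Set.Ioc_subset_Icc_self hy)) k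
    have h : ∀ τ B : ℝ, Real.exp (lam * b) * Real.exp (τ * d) * B *
        (Real.exp (-lam * b) * Real.exp (τ * d)) = Real.exp (2 * τ * d) * B := by
      intro τ B
      have : Real.exp (2 * τ * d) = Real.exp (lam * b) * Real.exp (τ * d) *
          (Real.exp (-lam * b) * Real.exp (τ * d)) := by
        simp only [← Real.exp_add]
        congr 1
        ring
      rw [this]
      ring
    rw [abs_neg, h, h] at hb
    have hpos := blockMass_pos hα hc k hd
    exact And.intro ((le_div_iff₀ hpos).2 hb.1) ((div_le_iff₀ hpos).2 hb.2)
  exact tendsto_of_tendsto_of_tendsto_of_le_of_le' (tendsto_exp_mul_nhdsGT_zero _)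
    (tendsto_exp_mul_nhdsGT_zero _) (hbd.mono fun d h ↦ h.1) (hbd.mono fun d h ↦ h.2)

/-! ### Convergence of moments -/

section Moments

lemma MeasureTheory.TendstoInDistribution.tendsto_integral_of_bounded {Ω' : ℕ → Type*}
    [∀ n, MeasurableSpace (Ω' n)] {P : (n : ℕ) → Measure (Ω' n)} [∀ n, IsProbabilityMeasure (P n)]
    {Ω : Type*} [MeasurableSpace Ω] {μ : Measure Ω} [IsProbabilityMeasure μ]
    {Y : (n : ℕ) → Ω' n → ℝ} {Z : Ω → ℝ} (h : TendstoInDistribution Y atTop Z P μ)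
    {φ : ℝ → ℝ} (hφ : Continuous φ) {C : ℝ} (hC : ∀ y, |φ y| ≤ C) :
    Tendsto (fun n ↦ ∫ ω, φ (Y n ω) ∂P n) atTop (𝓝 (∫ ω, φ (Z ω) ∂μ)) := by
  have := (ProbabilityMeasure.tendsto_iff_forall_integral_tendsto.1 h.tendsto)
    (BoundedContinuousFunction.ofNormedAddCommGroup φ hφ C hC)
  simp only [ProbabilityMeasure.coe_mk, BoundedContinuousFunction.coe_ofNormedAddCommGroup] at this
  rw [integral_map h.aemeasurable_limit hφ.aestronglyMeasurable] at this
  refine this.congr fun n ↦ ?_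
  rw [integral_map (h.forall_aemeasurable n) hφ.aestronglyMeasurable]

/-- If second moments converge, then first moments pass to the limit in distribution. -/
lemma MeasureTheory.TendstoInDistribution.integrable_and_integral_eq {Ω' : ℕ → Type*}
    [∀ n, MeasurableSpace (Ω' n)] {P : (n : ℕ) → Measure (Ω' n)} [∀ n, IsProbabilityMeasure (P n)]
    {Ω : Type*} [MeasurableSpace Ω] {μ : Measure Ω} [IsProbabilityMeasure μ]
    {Y : (n : ℕ) → Ω' n → ℝ} {Z : Ω → ℝ} (h : TendstoInDistribution Y atTop Z P μ)
    (hY : ∀ᶠ n in atTop, MemLp (Y n) 2 (P n)) {m₁ m₂ : ℝ}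
    (h₁ : Tendsto (fun n ↦ ∫ ω, Y n ω ∂P n) atTop (𝓝 m₁))
    (h₂ : Tendsto (fun n ↦ ∫ ω, Y n ω ^ 2 ∂P n) atTop (𝓝 m₂)) :
    Integrable Z μ ∧ ∫ ω, Z ω ∂μ = m₁ := by
  have hint : ∀ᶠ n in atTop, Integrable (Y n) (P n) := hY.mono fun n hn ↦ hn.integrable one_le_two
  have hZ : Integrable Z μ := by
    have hbound : ∀ N : ℕ, ∫ ω, min |Z ω| N ∂μ ≤ 1 + m₂ := by
      intro N
      refine le_of_tendsto_of_tendsto (h.tendsto_integral_of_bounded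
        (φ := fun y ↦ min |y| N) (by fun_prop) (C := N) fun y ↦ ?_) (h₂.const_add 1) ?_
      · rw [abs_of_nonneg (le_min (abs_nonneg _) (Nat.cast_nonneg _))]
        exact min_le_right _ _
      · filter_upwards [hY, hint] with n h2 h1
        calc ∫ ω, min |Y n ω| N ∂P n ≤ ∫ ω, (1 + Y n ω ^ 2) ∂P n := by
              refine integral_mono_of_nonneg (ae_of_all _ fun ω ↦
                le_min (abs_nonneg _) (Nat.cast_nonneg _))
                ((integrable_const _).add h2.integrable_sq) (ae_of_all _ fun ω ↦ ?_)
              refine (min_le_left _ _).trans ?_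
              simp only
              nlinarith [sq_abs (Y n ω), sq_nonneg (|Y n ω| - 1), abs_nonneg (Y n ω)]
          _ = 1 + ∫ ω, Y n ω ^ 2 ∂P n := by
              rw [integral_add (integrable_const _) h2.integrable_sq]
              simp
    refine ⟨h.aemeasurable_limit.aestronglyMeasurable, ?_⟩
    have hmono := lintegral_tendsto_of_tendsto_of_monotone (μ := μ)
      (f := fun (N : ℕ) ω ↦ ENNReal.ofReal (min |Z ω| N)) (F := fun ω ↦ ENNReal.ofReal |Z ω|)
      (fun N ↦ by have := h.aemeasurable_limit; fun_prop)
      (ae_of_all _ fun ω N N' hN ↦ ENNReal.ofReal_le_ofReal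
        (min_le_min_left _ (by exact_mod_cast hN)))
      (ae_of_all _ fun ω ↦ by
        refine tendsto_const_nhds.congr' ?_
        obtain ⟨N₀, hN₀⟩ := exists_nat_ge |Z ω|
        filter_upwards [eventually_ge_atTop N₀] with N hN
        rw [min_eq_left (hN₀.trans (by exact_mod_cast hN))])
    have hle : ∫⁻ ω, ENNReal.ofReal |Z ω| ∂μ ≤ ENNReal.ofReal (1 + m₂) := by
      refine le_of_tendsto' hmono fun N ↦ ?_
      rw [← ofReal_integral_eq_lintegral_ofReal]
      · exact ENNReal.ofReal_le_ofReal (hbound N)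
      · refine (integrable_const (N : ℝ)).mono'
          (by have := h.aemeasurable_limit; fun_prop) (ae_of_all _ fun ω ↦ ?_)
        rw [Real.norm_eq_abs, abs_of_nonneg (le_min (abs_nonneg _) (Nat.cast_nonneg _))]
        exact min_le_right _ _
      · exact ae_of_all _ fun ω ↦ le_min (abs_nonneg _) (Nat.cast_nonneg _)
    rw [hasFiniteIntegral_iff_norm]
    exact hle.trans_lt ENNReal.ofReal_lt_top
  refine ⟨hZ, ?_⟩
  -- truncation at level `N`
  set φ : ℕ → ℝ → ℝ := fun N y ↦ max (-(N : ℝ)) (min y N) with hφ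
  have hφc : ∀ N, Continuous (φ N) := fun N ↦ by simp only [hφ]; fun_prop
  have hφN : ∀ N y, |φ N y| ≤ N := fun N y ↦ by
    have : (0 : ℝ) ≤ N := Nat.cast_nonneg N
    exact abs_le.2 ⟨le_max_left _ _, max_le (by linarith) (min_le_right _ _)⟩
  have hφy : ∀ N y, |φ N y| ≤ |y| := fun N y ↦ by
    have : (0 : ℝ) ≤ N := Nat.cast_nonneg N
    refine abs_le.2 ⟨?_, max_le (by linarith [abs_nonneg y]) ((min_le_left _ _).trans
      (le_abs_self y))⟩
    rcases le_total y N with h' | h'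
    · exact (neg_abs_le y).trans ((min_eq_left h').symm.le.trans (le_max_right _ _))
    · exact le_trans (by linarith [abs_nonneg y]) ((min_eq_right h').symm.le.trans
        (le_max_right _ _))
  have hφd : ∀ N : ℕ, 0 < N → ∀ y, |φ N y - y| ≤ y ^ 2 / N := by
    intro N hN y
    have hN' : (0 : ℝ) < N := by exact_mod_cast hN
    rw [le_div_iff₀ hN']
    simp only [hφ]
    rcases le_total y N with h' | h'
    · rw [min_eq_left h']
      rcases le_total (-(N : ℝ)) y with h'' | h''
      · rw [max_eq_right h'']
        simp [sq_nonneg]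
      · rw [max_eq_left h'', abs_of_nonneg (by linarith)]
        nlinarith [sq_nonneg (y + N)]
    · rw [min_eq_right h', max_eq_right (by linarith), abs_of_nonpos (by linarith)]
      nlinarith [sq_nonneg (y - N)]
  have hlimZ : Tendsto (fun N ↦ ∫ ω, φ N (Z ω) ∂μ) atTop (𝓝 (∫ ω, Z ω ∂μ)) := by
    refine tendsto_integral_of_dominated_convergence (fun ω ↦ |Z ω|)
      (fun N ↦ (hφc N).comp_aestronglyMeasurable hZ.aestronglyMeasurable) hZ.abs
      (fun N ↦ ae_of_all _ fun ω ↦ hφy N (Z ω)) (ae_of_all _ fun ω ↦ ?_)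
    refine tendsto_const_nhds.congr' ?_
    obtain ⟨N₀, hN₀⟩ := exists_nat_ge |Z ω|
    filter_upwards [eventually_ge_atTop N₀] with N hN
    have hN' : |Z ω| ≤ N := hN₀.trans (by exact_mod_cast hN)
    have := abs_le.1 hN'
    simp only [hφ]
    rw [min_eq_left this.2, max_eq_right this.1]
  have hclose : ∀ N : ℕ, 0 < N → |∫ ω, φ N (Z ω) ∂μ - m₁| ≤ m₂ / N := by
    intro N hN
    refine le_of_tendsto_of_tendsto (((h.tendsto_integral_of_bounded (hφc N)
      (hφN N)).sub h₁).abs) (h₂.div_const _) ?_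
    filter_upwards [hY, hint] with n h2 h1
    have hφi : Integrable (fun ω ↦ φ N (Y n ω)) (P n) :=
      h1.abs.mono' ((hφc N).comp_aestronglyMeasurable h1.aestronglyMeasurable)
        (ae_of_all _ fun ω ↦ hφy N _)
    rw [← integral_sub hφi h1, ← integral_div]
    refine (abs_integral_le_integral_abs).trans ?_
    exact integral_mono_of_nonneg (ae_of_all _ fun ω ↦ abs_nonneg _)
      (h2.integrable_sq.div_const _) (ae_of_all _ fun ω ↦ hφd N hN _)
  have hlim : Tendsto (fun N ↦ ∫ ω, φ N (Z ω) ∂μ) atTop (𝓝 m₁) := by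
    rw [tendsto_iff_norm_sub_tendsto_zero]
    refine squeeze_zero' (Eventually.of_forall fun N ↦ norm_nonneg _)
      ((eventually_gt_atTop 0).mono fun N hN ↦ hclose N hN)
      (tendsto_const_div_atTop_nhds_zero_nat m₂)
  exact tendsto_nhds_unique hlimZ hlim

variable {Ω' : ℕ → Type*} [∀ n, MeasurableSpace (Ω' n)] {P : (n : ℕ) → Measure (Ω' n)}
  [∀ n, IsProbabilityMeasure (P n)] {m : ℕ} {S : (n : ℕ) → Fin m → Ω' n → ℝ} {s : ℕ → ℝ}

/-- The scaled joint moments have the same limits as the scaled joint factorial moments. -/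
lemma tendsto_integral_prod_pow_mul_descPochhammer
    (hS : ∀ᶠ n in atTop, ∀ i, MemLp (S n i) ⊤ (P n)) (hs : Tendsto s atTop atTop)
    {L : (Fin m → ℕ) → ℝ}
    (hL : ∀ k : Fin m → ℕ, Tendsto (fun n ↦
      (∫ ω, ∏ i, (descPochhammer ℝ (k i)).eval (S n i ω) ∂P n) / s n ^ ∑ i, k i) atTop (𝓝 (L k)))
    (N : ℕ) (a k : Fin m → ℕ) (ha : ∑ i, a i = N) :
    Tendsto (fun n ↦
      (∫ ω, ∏ i, (S n i ω ^ a i * (descPochhammer ℝ (k i)).eval (S n i ω)) ∂P n) /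
        s n ^ ∑ i, (a i + k i)) atTop (𝓝 (L fun i ↦ a i + k i)) := by
  induction N generalizing a k with
  | zero =>
    have ha0 : ∀ i, a i = 0 := fun i ↦ Finset.sum_eq_zero_iff.1 ha i (Finset.mem_univ i)
    simpa [ha0] using hL k
  | succ N ih =>
    obtain ⟨i, -, hi⟩ : ∃ i ∈ Finset.univ, a i ≠ 0 := by
      by_contra! hcon
      rw [Finset.sum_eq_zero hcon] at ha
      omega
    -- one factor `S i` is absorbed through `S * D k = D (k + 1) + k * D k`, where `D` is the
    -- falling factorial; the second term is of lower order
    set a' : Fin m → ℕ := Function.update a i (a i - 1) with ha'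
    set k' : Fin m → ℕ := Function.update k i (k i + 1) with hk'
    have hsuma : ∑ j, a' j = N := by
      have h1 := Finset.sum_update_of_mem (Finset.mem_univ i) a (a i - 1)
      have h2 := Finset.add_sum_erase Finset.univ a (Finset.mem_univ i)
      rw [Finset.sdiff_singleton_eq_erase] at h1
      rw [ha', h1]
      omega
    have hak : (fun j ↦ a' j + k' j) = fun j ↦ a j + k j := by
      funext j
      by_cases hj : j = i
      · subst hj; simp only [ha', hk', Function.update_self]; omega
      · simp only [ha', hk', Function.update_of_ne hj]
    have hexp : ∑ j, (a j + k j) = ∑ j, (a' j + k j) + 1 := by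
      rw [Finset.sum_add_distrib, Finset.sum_add_distrib, ha, hsuma]
      ring
    have h1 := ih a' k' hsuma
    have h2 := ih a' k hsuma
    rw [show (∑ j, (a' j + k' j)) = ∑ j, (a j + k j) by rw [hak]] at h1
    rw [show (fun j ↦ a' j + k' j) = fun j ↦ a j + k j from hak] at h1
    have h3 := h1.add ((h2.mul hs.inv_tendsto_atTop).const_mul (k i : ℝ))
    rw [mul_zero, mul_zero, add_zero] at h3
    refine h3.congr' ?_
    filter_upwards [hS, hs.eventually_gt_atTop 0] with n hn hsn
    have hi1 : ∀ k : Fin m → ℕ, Integrable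
        (fun ω ↦ ∏ j, (S n j ω ^ a' j * (descPochhammer ℝ (k j)).eval (S n j ω))) (P n) := fun k ↦
      MemLp.integrable (q := ⊤) le_top (memLp_top_prod _ fun j _ ↦
        memLp_top_mul (memLp_top_pow (hn j) _) (memLp_top_descPochhammer (hn j) _))
    have hpt : ∀ ω, ∏ j, (S n j ω ^ a j * (descPochhammer ℝ (k j)).eval (S n j ω)) =
        ∏ j, (S n j ω ^ a' j * (descPochhammer ℝ (k' j)).eval (S n j ω)) +
          k i * ∏ j, (S n j ω ^ a' j * (descPochhammer ℝ (k j)).eval (S n j ω)) := by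
      intro ω
      rw [← Finset.mul_prod_erase _ _ (Finset.mem_univ i),
        ← Finset.mul_prod_erase _ _ (Finset.mem_univ i),
        ← Finset.mul_prod_erase _ _ (Finset.mem_univ i)]
      have he : ∀ κ : Fin m → ℕ, (∀ j, j ≠ i → κ j = k j) → ∀ β : Fin m → ℕ,
          (∀ j, j ≠ i → β j = a j) →
          ∏ j ∈ Finset.univ.erase i, (S n j ω ^ β j * (descPochhammer ℝ (κ j)).eval (S n j ω)) =
          ∏ j ∈ Finset.univ.erase i, (S n j ω ^ a j * (descPochhammer ℝ (k j)).eval (S n j ω)) := by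
        intro κ hκ β hβ
        refine Finset.prod_congr rfl fun j hj ↦ ?_
        rw [hκ j (Finset.ne_of_mem_erase hj), hβ j (Finset.ne_of_mem_erase hj)]
      rw [he k' (fun j hj ↦ by simp only [hk', Function.update_of_ne hj]) a'
          (fun j hj ↦ by simp only [ha', Function.update_of_ne hj]),
        he k (fun _ _ ↦ rfl) a' (fun j hj ↦ by simp only [ha', Function.update_of_ne hj])]
      simp only [ha', hk', Function.update_self, descPochhammer_succ_eval]
      obtain ⟨r, hr⟩ := Nat.exists_eq_succ_of_ne_zero hi
      rw [hr, Nat.succ_sub_one, pow_succ]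
      ring
    simp_rw [hpt]
    rw [integral_add (hi1 k') ((hi1 k).const_mul _), integral_const_mul, hexp, pow_succ]
    simp only [Pi.inv_apply]
    field_simp

/-- If all scaled joint factorial moments converge, then every limit in distribution of a monomial
in the scaled variables has the limiting moment as its mean: the square of the monomial is again
a monomial, so that its means are bounded. -/
lemma integrable_and_integral_eq_of_factorial_moments
    (hS : ∀ᶠ n in atTop, ∀ i, MemLp (S n i) ⊤ (P n)) (hs : Tendsto s atTop atTop)
    {L : (Fin m → ℕ) → ℝ}
    (hL : ∀ k : Fin m → ℕ, Tendsto (fun n ↦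
      (∫ ω, ∏ i, (descPochhammer ℝ (k i)).eval (S n i ω) ∂P n) / s n ^ ∑ i, k i) atTop (𝓝 (L k)))
    {Ω : Type*} [MeasurableSpace Ω] {μ : Measure Ω} [IsProbabilityMeasure μ] {Z : Ω → ℝ}
    (k : Fin m → ℕ)
    (h : TendstoInDistribution (fun n ω ↦ ∏ i, (S n i ω / s n) ^ k i) atTop Z P μ) :
    Integrable Z μ ∧ ∫ ω, Z ω ∂μ = L k := by
  have hmom : ∀ k : Fin m → ℕ, Tendsto (fun n ↦ ∫ ω, ∏ i, (S n i ω / s n) ^ k i ∂P n) atTop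
      (𝓝 (L k)) := by
    intro k
    have := tendsto_integral_prod_pow_mul_descPochhammer hS hs hL _ k (fun _ ↦ 0) rfl
    simp only [descPochhammer_zero, Polynomial.eval_one, mul_one, add_zero] at this
    refine this.congr fun n ↦ ?_
    rw [← integral_div]
    simp_rw [div_pow, Finset.prod_div_distrib, Finset.prod_pow_eq_pow_sum]
  refine h.integrable_and_integral_eq ?_ (hmom k)
    (m₂ := L fun i ↦ k i * 2) ?_
  · filter_upwards [hS] with n hn
    refine MemLp.mono_exponent (q := ⊤) (memLp_top_prod _ fun i _ ↦ memLp_top_pow ?_ _) le_top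
    simp_rw [div_eq_mul_inv]
    exact (hn i).mul_const _
  · refine (hmom _).congr fun n ↦ ?_
    simp_rw [← Finset.prod_pow, ← pow_mul]

end Moments

/-! ### Moments of the limiting processes -/

section Processes

variable {Ω' : ℕ → Type*} [∀ n, MeasurableSpace (Ω' n)] {P : (n : ℕ) → Measure (Ω' n)}
  [∀ n, IsProbabilityMeasure (P n)] {ξ : (n : ℕ) → ℕ → Ω' n → ℝ}
  {Ω : Type*} [MeasurableSpace Ω] {μ : Measure Ω} [IsProbabilityMeasure μ]
  {X : ℝ → Ω → ℝ} {α c lam β T : ℝ}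

lemma scaledWalk_eq {Ω₀ : Type*} [MeasurableSpace Ω₀] (α : ℝ) (n : ℕ) (ζ : ℕ → Ω₀ → ℝ) (t : ℝ)
    (ω : Ω₀) :
    scaledWalk α n ζ t ω = (∑ q ∈ Finset.Ioc ⌊n * (0 : ℝ)⌋₊ ⌊n * t⌋₊, ζ q ω) / (n : ℝ) ^ α := by
  rw [scaledWalk, mul_zero, Nat.floor_zero]
  rfl

lemma scaledWalk_sub_scaledWalk {Ω₀ : Type*} [MeasurableSpace Ω₀] (α : ℝ) (n : ℕ) (ζ : ℕ → Ω₀ → ℝ)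
    {a b : ℝ} (hab : a ≤ b) (ω : Ω₀) :
    scaledWalk α n ζ b ω - scaledWalk α n ζ a ω =
      (∑ q ∈ Finset.Ioc ⌊n * a⌋₊ ⌊n * b⌋₊, ζ q ω) / (n : ℝ) ^ α := by
  have hfl : ⌊n * a⌋₊ ≤ ⌊n * b⌋₊ := Nat.floor_mono (by gcongr)
  rw [scaledWalk_eq, scaledWalk_eq, ← sub_div, mul_zero, Nat.floor_zero,
    ← Finset.sum_Ioc_consecutive _ (Nat.zero_le _) hfl, add_sub_cancel_left]

lemma TendstoFDD.tendstoInDistribution_prod_increments {S : Set ℝ}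
    (h : TendstoFDD P (fun n ↦ scaledWalk α n (ξ n)) μ X S) {m : ℕ} (a b : Fin m → ℝ)
    (ha : ∀ i, a i ∈ S) (hb : ∀ i, b i ∈ S) (hab : ∀ i, a i ≤ b i) (k : Fin m → ℕ) :
    TendstoInDistribution (fun (n : ℕ) ω ↦ ∏ i,
      ((∑ q ∈ Finset.Ioc ⌊n * a i⌋₊ ⌊n * b i⌋₊, ξ n q ω) / (n : ℝ) ^ α) ^ k i) atTop
      (fun ω ↦ ∏ i, (X (b i) ω - X (a i) ω) ^ k i) P μ := by
  have := (h (m + m) (Fin.append a b) (by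
    intro i
    induction i using Fin.addCases with
    | left i => rw [Fin.append_left]; exact ha i
    | right i => rw [Fin.append_right]; exact hb i)).continuous_comp
    (g := fun v : Fin (m + m) → ℝ ↦ ∏ i : Fin m, (v (Fin.natAdd m i) - v (Fin.castAdd m i)) ^ k i)
    (by fun_prop)
  refine this.congr (fun n ↦ ae_of_all _ fun ω ↦ ?_) (ae_of_all _ fun ω ↦ ?_)
  · simp only [Function.comp_apply, Fin.append_left, Fin.append_right]
    exact Finset.prod_congr rfl fun i _ ↦ by rw [scaledWalk_sub_scaledWalk α n _ (hab i)]
  · simp only [Function.comp_apply, Fin.append_left, Fin.append_right]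

lemma tendsto_natCast_rpow_atTop (hα : 0 < α) :
    Tendsto (fun n : ℕ ↦ (n : ℝ) ^ α) atTop atTop :=
  (tendsto_rpow_atTop hα).comp tendsto_natCast_atTop_atTop

/-- Joint moments of limits of the numbers of successes of a GBP* in consecutive blocks. -/
lemma IsWalkLimitStar.integral_eq (hα : 0 < α) (hα1 : α ≤ 1) (hc : 0 < c)
    (h : IsWalkLimitStar α c lam P ξ μ X) {m : ℕ} (a b : Fin m → ℝ) (ha : ∀ i, 0 ≤ a i)
    (hab : ∀ i, a i ≤ b i) (hba : ∀ i j, i < j → b i ≤ a j) (k : Fin m → ℕ) {Z : Ω → ℝ}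
    (hZ : TendstoInDistribution (fun (n : ℕ) ω ↦ ∏ i,
      ((∑ q ∈ Finset.Ioc ⌊n * a i⌋₊ ⌊n * b i⌋₊, ξ n q ω) / (n : ℝ) ^ α) ^ k i) atTop Z P μ) :
    Integrable Z μ ∧ ∫ ω, Z ω ∂μ = (∏ i, ((k i).factorial : ℝ)) *
      chainPotential α c (fun y ↦ Real.exp (-lam * y)) (blockList k fun i ↦ (a i, b i)) 0 := by
  refine integrable_and_integral_eq_of_factorial_moments
    (S := fun n i ω ↦ ∑ q ∈ Finset.Ioc ⌊n * a i⌋₊ ⌊n * b i⌋₊, ξ n q ω)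
    (L := fun k ↦ (∏ i, ((k i).factorial : ℝ)) *
      chainPotential α c (fun y ↦ Real.exp (-lam * y)) (blockList k fun i ↦ (a i, b i)) 0)
    ?_ (tendsto_natCast_rpow_atTop hα) (fun k ↦ ?_) k hZ
  · filter_upwards [h.steps] with n hn i
    refine memLp_finsetSum _ fun q hq ↦ ?_
    have hq1 : 1 ≤ q := by simp only [Finset.mem_Ioc] at hq; omega
    exact memLp_top_of_binary (hn.aemeasurable q hq1) (hn.binary q hq1)
  · have hlim := (chainWeight_scaling (lam := lam) hα hα1 hc.le (blockList k fun i ↦ (a i, b i))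
      (fun J hJ ↦ by
        obtain ⟨i, rfl⟩ := mem_blockList hJ
        exact ⟨ha i, (ha i).trans (hab i)⟩)).2 (fun _ ↦ 0) 0 le_rfl (by simp)
    rw [mul_zero, Real.exp_zero, one_mul] at hlim
    refine (hlim.const_mul _).congr' ?_
    filter_upwards [h.steps] with n hn
    rw [hn.integral_prod_descPochhammer k (fun i ↦ ⌊n * a i⌋₊) (fun i ↦ ⌊n * b i⌋₊)
      (fun i ↦ Nat.floor_mono (by gcongr; exact hab i))
      (fun i j hij ↦ Nat.floor_mono (by gcongr; exact hba i j hij)), latticeIntervals,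
      map_blockList, length_blockList, mul_div_assoc]

/-- Moments of limits of the number of successes of a GBP in a block. -/
lemma IsWalkLimit.integral_eq (hα : 0 < α) (hα1 : α ≤ 1) (hc : 0 < c) (hT : 0 < T)
    (h : IsWalkLimit α c lam β T P ξ μ X) {a b : ℝ} (ha : 0 ≤ a) (hab : a ≤ b) (hbT : b ≤ T)
    (k : ℕ) {Z : Ω → ℝ}
    (hZ : TendstoInDistribution (fun (n : ℕ) ω ↦ ∏ _i : Fin 1,
      ((∑ q ∈ Finset.Ioc ⌊n * a⌋₊ ⌊n * b⌋₊, ξ n q ω) / (n : ℝ) ^ α) ^ (k + 1)) atTop Z P μ) :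
    Integrable Z μ ∧ ∫ ω, Z ω ∂μ = (k + 1).factorial *
      (c * β * Real.exp (-lam * T) * T ^ (α - 1)) *
      ∫ y in Set.Ioc a b, Real.exp (lam * y) *
        chainPotential α c (fun y ↦ Real.exp (-lam * y)) (List.replicate k (a, b)) y := by
  set I : ℕ → ℝ := fun k ↦ (k + 1).factorial * (c * β * Real.exp (-lam * T) * T ^ (α - 1)) *
      ∫ y in Set.Ioc a b, Real.exp (lam * y) *
        chainPotential α c (fun y ↦ Real.exp (-lam * y)) (List.replicate k (a, b)) y with hI
  have hb : 0 ≤ b := ha.trans hab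
  refine integrable_and_integral_eq_of_factorial_moments
    -- the stationary factor occurs only for positive exponents, so that `0` is a separate case
    (S := fun n (_ : Fin 1) ω ↦ ∑ q ∈ Finset.Ioc ⌊n * a⌋₊ ⌊n * b⌋₊, ξ n q ω)
    (L := fun k ↦ Nat.casesOn (k 0) 1 I) ?_ (tendsto_natCast_rpow_atTop hα) (fun k ↦ ?_)
    (fun _ ↦ k + 1) hZ
  · filter_upwards [h.steps] with n hn i
    refine memLp_finsetSum _ fun q hq ↦ ?_
    have hfl : ⌊n * b⌋₊ ≤ ⌊n * T⌋₊ := Nat.floor_mono (by gcongr)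
    have hq1 : q ∈ Finset.Icc 1 ⌊n * T⌋₊ := by
      simp only [Finset.mem_Ioc, Finset.mem_Icc] at hq ⊢; omega
    exact memLp_top_of_binary (hn.aemeasurable q hq1) (hn.binary q hq1)
  · simp only [Fin.prod_univ_one, Fin.sum_univ_one]
    rcases hk : k 0 with _ | j
    · simp
    · simp only
      obtain ⟨⟨M, hM0, hM⟩, hlim⟩ := chainWeight_scaling (lam := lam) hα hα1 hc.le
        (List.replicate j (a, b)) (fun J hJ ↦ by
          rw [List.eq_of_mem_replicate hJ]
          exact ⟨ha, hb⟩)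
      -- the sum over the first success is a sum with the constant weight `1`
      have hsum := (tendsto_scaled_sum (α := 1) (c := 1) (lam := 0) one_pos le_rfl zero_le_one hM0
        hM hlim ha hb).2 (fun _ ↦ 0) 0 le_rfl (by simp)
      simp only [temperedPower, neg_zero, zero_mul, zero_div, Real.exp_zero, sub_self,
        Real.rpow_zero, mul_one, one_mul, Real.rpow_one, max_eq_left ha, Nat.max_zero] at hsum
      have hN : Tendsto (fun n : ℕ ↦ (⌊n * T⌋₊ / n : ℝ)) atTop (𝓝 T) := by
        have := (tendsto_nat_floor_mul_div_atTop hT.le).comp tendsto_natCast_atTop_atTop (α := ℕ)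
        refine this.congr fun n ↦ ?_
        simp only [Function.comp_apply, mul_comm T]
      have hf : Tendsto (fun n : ℕ ↦ β * (c * Real.exp (-lam * (⌊n * T⌋₊ / n : ℝ)) *
          (⌊n * T⌋₊ / n : ℝ) ^ (α - 1))) atTop
          (𝓝 (β * (c * Real.exp (-lam * T) * T ^ (α - 1)))) :=
        (((Real.continuous_exp.tendsto _).comp (hN.const_mul _)).const_mul c |>.mul
          (hN.rpow_const (Or.inl hT.ne'))).const_mul β
      have hprod := (hf.mul hsum).const_mul ((j + 1).factorial : ℝ)
      have hval : ((j + 1).factorial : ℝ) * (β * (c * Real.exp (-lam * T) * T ^ (α - 1)) *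
          ∫ y in Set.Ioc a b, Real.exp (lam * y) *
            chainPotential α c (fun y ↦ Real.exp (-lam * y)) (List.replicate j (a, b)) y) = I j := by
        rw [hI]
        ring
      rw [hval] at hprod
      refine hprod.congr' ?_
      filter_upwards [h.steps, eventually_gt_atTop 0] with n hn hn0
      have hn' : (0 : ℝ) < n := by exact_mod_cast hn0
      rw [hn.integral_descPochhammer j (Nat.floor_mono (by gcongr))
        (Nat.floor_mono (by gcongr)), ← rpow_mul_temperedPower α c lam hn0,
        latticeIntervals, List.map_replicate, List.length_replicate, ← Finset.sum_div, pow_succ]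
      field_simp

end Processes

/-! ### Explicit moment formulas -/

/-- The tempering sits in the terminal function, so that a power of the fractional integral acts on
`exp (-lam * y)`. -/
lemma chainPotential_initial_block {α c : ℝ} (hα : 0 < α) (lam : ℝ) {t : ℝ} (ht : 0 < t) (k : ℕ) :
    chainPotential α c (fun y ↦ Real.exp (-lam * y)) (List.replicate (k + 1) (0, t)) 0 =
      t ^ ((k + 1 : ℕ) * α) * ((c * Real.Gamma α) ^ (k + 1) / Real.Gamma ((k + 1 : ℕ) * α)) *
        ∫ y in (0 : ℝ)..1, Real.exp (-lam * t * y) * y ^ ((k + 1 : ℕ) * α - 1) := by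
  have hM : ∀ y ∈ Set.Ioc 0 t, |Real.exp (-lam * y)| ≤
      Real.exp (-lam * t) * Real.exp (|-lam| * t) := by
    intro y hy
    rw [Real.abs_exp]
    exact (exp_mul_bounds (-lam) (b := t) (d := t) (by
      rw [sub_self]; exact Set.Ioc_subset_Icc_self hy)).2
  rw [chainPotential_replicate hα (by fun_prop) hM k le_rfl, mul_comm (t ^ _), mul_assoc]
  congr 1
  have hsub := intervalIntegral.mul_integral_comp_mul_left (a := 0) (b := 1) (c := t)
    (f := fun y ↦ (y - 0) ^ (((k + 1 : ℕ) : ℝ) * α - 1) * Real.exp (-lam * y))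
  rw [mul_zero, mul_one, intervalIntegral.integral_of_le ht.le] at hsub
  rw [← hsub, ← intervalIntegral.integral_const_mul, ← intervalIntegral.integral_const_mul]
  refine intervalIntegral.integral_congr fun y hy ↦ ?_
  rw [Set.uIcc_of_le zero_le_one] at hy
  simp only [sub_zero]
  rw [Real.mul_rpow ht.le hy.1, Real.rpow_sub_one ht.ne', mul_assoc (-lam)]
  field_simp

/-- The integrals are exchanged, so that the later point is the outer variable, and rescaled by
`s`. -/
lemma chainPotential_pair {α c : ℝ} (hα : 0 < α) (lam : ℝ) {t s : ℝ} (ht : 0 < t) (hts : t < s) :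
    chainPotential α c (fun y ↦ Real.exp (-lam * y)) [(0, t), (t, s)] 0 =
      s ^ (2 * α) * c ^ 2 * ∫ x₂ in (t / s)..1, ∫ x₁ in (0 : ℝ)..(t / s),
        x₁ ^ (α - 1) * (x₂ - x₁) ^ (α - 1) * Real.exp (-lam * s * x₂) := by
  have hs : 0 < s := ht.trans hts
  set g : ℝ × ℝ → ℝ := fun z ↦ (Set.Iic t).indicator (fun _ ↦ (1 : ℝ)) z.1 *
    (Set.Ioc t s).indicator (fun y ↦ Real.exp (-lam * y)) z.2 with hg
  have hgm : Measurable g :=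
    ((measurable_const.indicator measurableSet_Iic).comp measurable_fst).mul
      (((by fun_prop : Measurable fun y : ℝ ↦ Real.exp (-lam * y)).indicator
        measurableSet_Ioc).comp measurable_snd)
  have hgM : ∀ z, |g z| ≤ Real.exp (-lam * s) * Real.exp (|-lam| * s) := by
    intro z
    simp only [hg, Set.indicator_apply]
    split_ifs with h1 h2
    · rw [one_mul, Real.abs_exp]
      exact (exp_mul_bounds (-lam) (b := s) (d := s)
        (by rw [sub_self]; exact ⟨(ht.trans h2.1).le, h2.2⟩)).2
    all_goals
      simp only [mul_zero, zero_mul, abs_zero]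
      positivity
  have hswap := integral_swap_triangle hα hα 0 s hgm hgM
  have hleft : chainPotential α c (fun y ↦ Real.exp (-lam * y)) [(0, t), (t, s)] 0 = c ^ 2 *
      ∫ z, ∫ y, (if 0 < z ∧ z < y ∧ y ≤ s then
        (z - 0) ^ (α - 1) * (y - z) ^ (α - 1) else 0) * g (z, y) := by
    simp only [chainPotential, max_self]
    rw [← integral_indicator measurableSet_Ioc, ← integral_const_mul]
    refine integral_congr_ae (ae_of_all _ fun z ↦ ?_)
    simp only [Set.indicator_apply]
    split_ifs with hz
    · rw [max_eq_left hz.2, ← integral_indicator measurableSet_Ioc, ← integral_const_mul,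
        ← integral_const_mul]
      refine integral_congr_ae (ae_of_all _ fun y ↦ ?_)
      simp only [Set.indicator_apply, hg, Set.mem_Ioc, Set.mem_Iic]
      by_cases hy : t < y ∧ y ≤ s
      · rw [if_pos hy, if_pos hy, if_pos hz.2, if_pos ⟨hz.1, hz.2.trans_lt hy.1, hy.2⟩]
        ring
      · rw [if_neg hy, if_neg hy]
        simp
    · symm
      rw [mul_eq_zero]
      right
      refine integral_eq_zero_of_ae (ae_of_all _ fun y ↦ ?_)
      simp only [hg, Set.indicator_apply, Set.mem_Iic, Pi.zero_apply]
      by_cases h0 : 0 < z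
      · rw [if_neg (fun h ↦ hz ⟨h0, h⟩)]
        simp
      · rw [if_neg (fun h ↦ h0 h.1), zero_mul]
  set I : ℝ → ℝ := fun y ↦ ∫ z in (0 : ℝ)..t,
    z ^ (α - 1) * (y - z) ^ (α - 1) * Real.exp (-lam * y) with hI
  have hright : ∫ y, ∫ z, (if 0 < z ∧ z < y ∧ y ≤ s then
      (z - 0) ^ (α - 1) * (y - z) ^ (α - 1) else 0) * g (z, y) = ∫ y in t..s, I y := by
    rw [intervalIntegral.integral_of_le hts.le, ← integral_indicator measurableSet_Ioc]
    refine integral_congr_ae (ae_of_all _ fun y ↦ ?_)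
    simp only [Set.indicator_apply]
    split_ifs with hy
    · simp only [hI]
      rw [intervalIntegral.integral_of_le ht.le, ← integral_indicator measurableSet_Ioc]
      refine integral_congr_ae (ae_of_all _ fun z ↦ ?_)
      simp only [Set.indicator_apply, hg, Set.mem_Iic, if_pos hy]
      by_cases hz : z ∈ Set.Ioc 0 t
      · rw [if_pos hz, if_pos ⟨hz.1, hz.2.trans_lt hy.1, hy.2⟩, if_pos hz.2, one_mul, sub_zero]
      · rw [if_neg hz]
        by_cases h0 : 0 < z
        · rw [if_neg (fun h : z ≤ t ↦ hz ⟨h0, h⟩)]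
          simp
        · rw [if_neg (fun h ↦ h0 h.1), zero_mul]
    · refine integral_eq_zero_of_ae (ae_of_all _ fun z ↦ ?_)
      simp only [hg, Set.indicator_apply, if_neg hy, mul_zero, Pi.zero_apply]
  have hscale : ∀ x ∈ Set.uIcc (t / s) 1, I (s * x) = s ^ (2 * α - 1) *
      ∫ x₁ in (0 : ℝ)..(t / s), x₁ ^ (α - 1) * (x - x₁) ^ (α - 1) * Real.exp (-lam * s * x) := by
    intro x hx
    rw [Set.uIcc_of_le ((div_le_one hs).2 hts.le)] at hx
    have hsub := intervalIntegral.mul_integral_comp_mul_left (a := 0) (b := t / s) (c := s)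
      (f := fun z ↦ z ^ (α - 1) * (s * x - z) ^ (α - 1) * Real.exp (-lam * (s * x)))
    rw [mul_zero, mul_div_cancel₀ t hs.ne'] at hsub
    simp only [hI]
    rw [← hsub, ← intervalIntegral.integral_const_mul, ← intervalIntegral.integral_const_mul]
    refine intervalIntegral.integral_congr fun z hz ↦ ?_
    rw [Set.uIcc_of_le (by positivity)] at hz
    rw [← mul_sub, Real.mul_rpow hs.le hz.1, Real.mul_rpow hs.le (by linarith [hz.2, hx.1]),
      show 2 * α - 1 = (α - 1) + (α - 1) + 1 by ring, Real.rpow_add_one hs.ne', Real.rpow_add hs,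
      mul_assoc (-lam)]
    ring
  have hsub := intervalIntegral.mul_integral_comp_mul_left (a := t / s) (b := 1) (c := s) (f := I)
  rw [mul_one, mul_div_cancel₀ t hs.ne'] at hsub
  rw [hleft, hswap, hright, ← hsub, intervalIntegral.integral_congr hscale,
    intervalIntegral.integral_const_mul, show s ^ (2 * α) = s ^ (2 * α - 1) * s by
      rw [Real.rpow_sub_one hs.ne']; field_simp]
  ring

section Star

variable {α c lam : ℝ} {Ω' : ℕ → Type*} [∀ n, MeasurableSpace (Ω' n)]
  {P : (n : ℕ) → Measure (Ω' n)} [∀ n, IsProbabilityMeasure (P n)] {ξ : (n : ℕ) → ℕ → Ω' n → ℝ}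
  {Ω : Type*} [MeasurableSpace Ω] {μ : Measure Ω} [IsProbabilityMeasure μ] {X : ℝ → Ω → ℝ}

lemma IsWalkLimitStar.moment (hα : 0 < α) (hα1 : α ≤ 1) (hc : 0 < c)
    (h : IsWalkLimitStar α c lam P ξ μ X) {k : ℕ} {t : ℝ} (hk : 1 ≤ k) (ht : 0 < t) :
    Integrable (fun ω ↦ X t ω ^ k) μ ∧
      ∫ ω, X t ω ^ k ∂μ =
        t ^ (k * α) * (k.factorial * (c * Real.Gamma α) ^ k / Real.Gamma (k * α)) *
          ∫ y in (0 : ℝ)..1, Real.exp (-lam * t * y) * y ^ (k * α - 1) := by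
  obtain ⟨k, rfl⟩ := Nat.exists_eq_add_of_le' hk
  have hdist := (h.limit 1 (fun _ ↦ t) (fun _ ↦ ht)).continuous_comp
    (g := fun v : Fin 1 → ℝ ↦ v 0 ^ (k + 1)) (by fun_prop)
  have hmom := h.integral_eq hα hα1 hc (m := 1) (fun _ ↦ 0) (fun _ ↦ t) (fun _ ↦ le_rfl)
    (fun _ ↦ ht.le) (fun i j hij ↦ by omega) (fun _ ↦ k + 1) (Z := fun ω ↦ X t ω ^ (k + 1))
    (hdist.congr (fun n ↦ ae_of_all _ fun ω ↦ by
      simp only [Function.comp_apply, Fin.prod_univ_one, scaledWalk_eq]) (ae_of_all _ fun ω ↦ rfl))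
  refine ⟨hmom.1, ?_⟩
  have hbl : blockList (fun _ : Fin 1 ↦ k + 1) (fun _ ↦ ((0 : ℝ), t)) =
      List.replicate (k + 1) (0, t) := by simp [blockList]
  rw [hmom.2, hbl, chainPotential_initial_block hα lam ht k, Fin.prod_univ_one]
  ring

lemma IsWalkLimitStar.mixed_moment (hα : 0 < α) (hα1 : α ≤ 1) (hc : 0 < c)
    (h : IsWalkLimitStar α c lam P ξ μ X) {t s : ℝ} (ht : 0 < t) (hts : t < s) :
    Integrable (fun ω ↦ X s ω * X t ω) μ ∧
      ∫ ω, X s ω * X t ω ∂μ =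
        s ^ (2 * α) * c ^ 2 *
          (∫ x₂ in (t / s)..1, ∫ x₁ in (0 : ℝ)..(t / s),
            x₁ ^ (α - 1) * (x₂ - x₁) ^ (α - 1) * Real.exp (-lam * s * x₂)) +
        t ^ (2 * α) * (2 * (c * Real.Gamma α) ^ 2 / Real.Gamma (2 * α)) *
          (∫ y in (0 : ℝ)..1, Real.exp (-lam * t * y) * y ^ (2 * α - 1)) := by
  -- `X s * X t = X t * (X s - X t) + X t ^ 2`
  have hdist := (h.limit 2 ![t, s] (fun i ↦ by
    fin_cases i
    · exact ht
    · exact ht.trans hts)).continuous_comp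
    (g := fun v : Fin 2 → ℝ ↦ v 0 * (v 1 - v 0)) (by fun_prop)
  have hmom := h.integral_eq hα hα1 hc (m := 2) ![0, t] ![t, s]
    (fun i ↦ by fin_cases i <;> simp [ht.le]) (fun i ↦ by fin_cases i <;> simp [ht.le, hts.le])
    (fun i j hij ↦ by
      fin_cases i <;> fin_cases j <;> simp at hij ⊢) (fun _ ↦ 1)
    (Z := fun ω ↦ X t ω * (X s ω - X t ω))
    (hdist.congr (fun n ↦ ae_of_all _ fun ω ↦ by
      simp only [Function.comp_apply, Fin.prod_univ_two, pow_one, Matrix.cons_val_zero,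
        Matrix.cons_val_one]
      rw [scaledWalk_sub_scaledWalk α n (ξ n) hts.le, scaledWalk_eq])
      (ae_of_all _ fun ω ↦ by simp))
  have hsq := h.moment hα hα1 hc (k := 2) one_le_two ht
  have heq : (fun ω ↦ X s ω * X t ω) = fun ω ↦ X t ω * (X s ω - X t ω) + X t ω ^ 2 := by
    funext ω
    ring
  rw [heq]
  refine ⟨hmom.1.add hsq.1, ?_⟩
  have hbl : (blockList (fun _ : Fin 2 ↦ 1) fun i ↦
      ((![0, t] : Fin 2 → ℝ) i, (![t, s] : Fin 2 → ℝ) i)) = [(0, t), (t, s)] := by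
    simp [blockList]
  rw [integral_add hmom.1 hsq.1, hmom.2, hsq.2, hbl, chainPotential_pair hα lam ht hts]
  simp

lemma IsWalkLimitStar.covariance_eq (hα : 0 < α) (hα1 : α ≤ 1) (hc : 0 < c)
    (h : IsWalkLimitStar α c lam P ξ μ X) {t s : ℝ} (ht : 0 < t) (hts : t < s) :
    covariance (X s) (X t) μ = ∫ ω, X s ω * X t ω ∂μ -
        (t * s) ^ α * c ^ 2 *
          (∫ y in (0 : ℝ)..1, Real.exp (-lam * t * y) * y ^ (α - 1)) *
          (∫ x in (0 : ℝ)..1, Real.exp (-lam * s * x) * x ^ (α - 1)) := by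
  have hs : 0 < s := ht.trans hts
  have hmean : ∀ r, 0 < r → MemLp (X r) 2 μ ∧
      ∫ ω, X r ω ∂μ = r ^ α * c * ∫ y in (0 : ℝ)..1, Real.exp (-lam * r * y) * y ^ (α - 1) := by
    intro r hr
    have h1 := h.moment hα hα1 hc (k := 1) le_rfl hr
    have h2 := h.moment hα hα1 hc (k := 2) one_le_two hr
    simp only [pow_one, Nat.cast_one, one_mul, Nat.factorial_one] at h1
    rw [mul_div_cancel_right₀ _ (Real.Gamma_pos_of_pos hα).ne'] at h1
    exact ⟨(memLp_two_iff_integrable_sq h1.1.aestronglyMeasurable).2 h2.1, h1.2⟩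
  rw [covariance_eq_sub (hmean s hs).1 (hmean t ht).1, (hmean s hs).2, (hmean t ht).2,
    Real.mul_rpow ht.le hs.le]
  simp only [Pi.mul_apply]
  ring

lemma sub_pos_of_lt_gap {m : ℕ} {t : Fin (m + 1) → ℝ} (ht : StrictMono t) (ht0 : t 0 = 0) {d : ℝ}
    (hd : ∀ i : Fin m, d < t i.succ - t i.castSucc) (i : Fin m) : 0 < t i.succ - d := by
  have h1 : t 0 ≤ t i.castSucc := ht.monotone (Fin.zero_le _)
  linarith [hd i]

lemma IsWalkLimitStar.increments (hα : 0 < α) (hα1 : α ≤ 1) (hc : 0 < c)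
    (h : IsWalkLimitStar α c lam P ξ μ X) {m : ℕ} {t : Fin (m + 1) → ℝ} (ht : StrictMono t)
    (ht0 : t 0 = 0) (k : Fin m → ℕ) :
    (∀ᶠ d in 𝓝[>] (0 : ℝ), Integrable
      (fun ω ↦ ∏ i : Fin m, (X (t i.succ) ω - X (t i.succ - d) ω) ^ (k i + 1)) μ) ∧
    (fun d ↦ ∫ ω, ∏ i : Fin m, (X (t i.succ) ω - X (t i.succ - d) ω) ^ (k i + 1) ∂μ)
      ~[𝓝[>] (0 : ℝ)]
    fun d ↦ (∏ i, ((k i + 1).factorial : ℝ)) *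
      ((∏ i : Fin m, c * (t i.succ - t i.castSucc) ^ (α - 1) * blockMass α c (k i) d) *
        Real.exp (-lam * t (Fin.last m))) := by
  have hev := (eventually_lt_gaps ht).mono fun d hd ↦
    h.integral_eq hα hα1 hc (fun i : Fin m ↦ t i.succ - d) (fun i ↦ t i.succ)
      (fun i ↦ (sub_pos_of_lt_gap ht ht0 hd.2 i).le) (fun i ↦ by linarith [hd.1])
      (fun i j hij ↦ by
        have h1 : t i.succ ≤ t j.castSucc := ht.monotone (Fin.succ_le_castSucc_iff.2 hij)
        linarith [hd.2 j]) (fun i ↦ k i + 1)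
      (h.limit.tendstoInDistribution_prod_increments _ _
        (fun i ↦ sub_pos_of_lt_gap ht ht0 hd.2 i)
        (fun i ↦ by
          have := sub_pos_of_lt_gap ht ht0 hd.2 i
          exact Set.mem_Ioi.2 (by linarith [hd.1]))
        (fun i ↦ by linarith [hd.1]) _)
  refine ⟨hev.mono fun d hd ↦ hd.1, ?_⟩
  refine IsEquivalent.congr_left ?_ (hev.mono fun d hd ↦ hd.2.symm)
  exact (IsEquivalent.refl (u := fun _ : ℝ ↦ ∏ i, ((k i + 1).factorial : ℝ))).mul
    (chainPotential_blockList_isEquivalent hα hα1 hc t ht ht0 k)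

end Star

lemma IsWalkLimit.increment {α c lam β T : ℝ} {Ω' : ℕ → Type*} [∀ n, MeasurableSpace (Ω' n)]
    {P : (n : ℕ) → Measure (Ω' n)} [∀ n, IsProbabilityMeasure (P n)] {ξ : (n : ℕ) → ℕ → Ω' n → ℝ}
    {Ω : Type*} [MeasurableSpace Ω] {μ : Measure Ω} [IsProbabilityMeasure μ] {X : ℝ → Ω → ℝ}
    (hα : 0 < α) (hα1 : α ≤ 1) (hc : 0 < c) (hT : 0 < T) (h : IsWalkLimit α c lam β T P ξ μ X)
    {t : ℝ} (ht : 0 < t) (htT : t ≤ T) (k : ℕ) :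
    (∀ᶠ d in 𝓝[>] (0 : ℝ), Integrable (fun ω ↦ (X t ω - X (t - d) ω) ^ (k + 1)) μ) ∧
    (fun d ↦ ∫ ω, (X t ω - X (t - d) ω) ^ (k + 1) ∂μ) ~[𝓝[>] (0 : ℝ)]
      fun d ↦ (k + 1).factorial * (c * β * Real.exp (-lam * T) * T ^ (α - 1)) *
        blockMass α c k d := by
  have hsmall : ∀ᶠ d : ℝ in 𝓝[>] 0, 0 < d ∧ d < t :=
    eventually_mem_nhdsWithin.and (nhdsWithin_le_nhds (eventually_lt_nhds ht))
  have hev := hsmall.mono fun d hd ↦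
    h.integral_eq hα hα1 hc hT (a := t - d) (b := t) (by linarith [hd.2]) (by linarith [hd.1]) htT k
      (h.limit.tendstoInDistribution_prod_increments (fun _ : Fin 1 ↦ t - d) (fun _ ↦ t)
        (fun _ ↦ ⟨by linarith [hd.2], by linarith [hd.1]⟩) (fun _ ↦ ⟨ht, htT⟩)
        (fun _ ↦ by linarith [hd.1]) (fun _ ↦ k + 1))
  simp only [Fin.prod_univ_one] at hev
  refine ⟨hev.mono fun d hd ↦ hd.1, ?_⟩
  refine IsEquivalent.congr_left ?_ (hev.mono fun d hd ↦ hd.2.symm)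
  exact (IsEquivalent.refl (u := fun _ : ℝ ↦
    (k + 1).factorial * (c * β * Real.exp (-lam * T) * T ^ (α - 1)))).mul
    (integral_exp_mul_chainPotential_isEquivalent hα hc t k)

theorem corollary3p5
    {α c lam T : ℝ} (hα0 : 0 < α) (hα1 : α ≤ 1) (hc0 : 0 < c) (hc1 : c < 2 ^ (α - 1))
    (hT : 0 < T) (hlam : (α - 1) / T < lam)
    -- `Xs` is the process `X^*`, the scaling limit of random walks that follow GBP*
    {Ωs' : ℕ → Type*} [∀ n, MeasurableSpace (Ωs' n)] (Ps : (n : ℕ) → Measure (Ωs' n))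
    [∀ n, IsProbabilityMeasure (Ps n)] (ξs : (n : ℕ) → ℕ → Ωs' n → ℝ)
    {Ωs : Type*} [MeasurableSpace Ωs] (μs : Measure Ωs) [IsProbabilityMeasure μs]
    (Xs : ℝ → Ωs → ℝ) (hXs : IsWalkLimitStar α c lam Ps ξs μs Xs) :
    -- moments
    (∀ (k : ℕ) (t : ℝ), 1 ≤ k → 0 < t →
      Integrable (fun ω ↦ Xs t ω ^ k) μs ∧
      ∫ ω, Xs t ω ^ k ∂μs =
        t ^ (k * α) * (k.factorial * (c * Real.Gamma α) ^ k / Real.Gamma (k * α)) *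
          ∫ y in (0 : ℝ)..1, Real.exp (-lam * t * y) * y ^ (k * α - 1)) ∧
    -- mixed second moments and covariances
    (∀ t s : ℝ, 0 < t → t < s →
      Integrable (fun ω ↦ Xs s ω * Xs t ω) μs ∧
      ∫ ω, Xs s ω * Xs t ω ∂μs =
        s ^ (2 * α) * c ^ 2 *
          (∫ x₂ in (t / s)..1, ∫ x₁ in (0 : ℝ)..(t / s),
            x₁ ^ (α - 1) * (x₂ - x₁) ^ (α - 1) * Real.exp (-lam * s * x₂)) +
        t ^ (2 * α) * (2 * (c * Real.Gamma α) ^ 2 / Real.Gamma (2 * α)) *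
          (∫ y in (0 : ℝ)..1, Real.exp (-lam * t * y) * y ^ (2 * α - 1)) ∧
      covariance (Xs s) (Xs t) μs =
        s ^ (2 * α) * c ^ 2 *
          (∫ x₂ in (t / s)..1, ∫ x₁ in (0 : ℝ)..(t / s),
            x₁ ^ (α - 1) * (x₂ - x₁) ^ (α - 1) * Real.exp (-lam * s * x₂)) +
        t ^ (2 * α) * (2 * (c * Real.Gamma α) ^ 2 / Real.Gamma (2 * α)) *
          (∫ y in (0 : ℝ)..1, Real.exp (-lam * t * y) * y ^ (2 * α - 1)) -
        (t * s) ^ α * c ^ 2 *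
          (∫ y in (0 : ℝ)..1, Real.exp (-lam * t * y) * y ^ (α - 1)) *
          (∫ x in (0 : ℝ)..1, Real.exp (-lam * s * x) * x ^ (α - 1))) ∧
    -- product of two small increments
    (∀ s t : ℝ, 0 < s → 0 < t →
      (∀ᶠ d in 𝓝[>] (0 : ℝ), Integrable
        (fun ω ↦ (Xs s ω - Xs (s - d) ω) * (Xs (s + t) ω - Xs (s + t - d) ω)) μs) ∧
      (fun d ↦ ∫ ω, (Xs s ω - Xs (s - d) ω) * (Xs (s + t) ω - Xs (s + t - d) ω) ∂μs)
        ~[𝓝[>] (0 : ℝ)]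
      (fun d ↦ c ^ 2 * d ^ 2 * Real.exp (-lam * (s + t)) * s ^ (α - 1) * t ^ (α - 1))) ∧
    -- products of powers of small increments at times `t 1 < ⋯ < t m`, where `t 0 = 0`
    (∀ (m : ℕ) (t : Fin (m + 1) → ℝ) (k : Fin m → ℕ),
      StrictMono t → t 0 = 0 → (∀ i, 1 ≤ k i) →
      (∀ᶠ d in 𝓝[>] (0 : ℝ), Integrable
        (fun ω ↦ ∏ i : Fin m, (Xs (t i.succ) ω - Xs (t i.succ - d) ω) ^ k i) μs) ∧
      (fun d ↦ ∫ ω, ∏ i : Fin m, (Xs (t i.succ) ω - Xs (t i.succ - d) ω) ^ k i ∂μs)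
        ~[𝓝[>] (0 : ℝ)]
      (fun d ↦ d ^ (∑ i, (α * ((k i : ℝ) - 1) + 1)) * Real.exp (-lam * t (Fin.last m)) *
        ∏ i : Fin m,
          ((k i).factorial * (c * Real.Gamma α) ^ (k i - 1) /
              Real.Gamma (((k i : ℝ) - 1) * α + 2) *
            (c * (t i.succ - t i.castSucc) ^ (α - 1))))) ∧
    -- comparison with the increments of `X`, the scaling limit of random walks that follow GBP
    (∀ (b : ℝ), 0 < b → b ≤ 1 →
      ∀ {Ω' : ℕ → Type*} [∀ n, MeasurableSpace (Ω' n)] (P : (n : ℕ) → Measure (Ω' n))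
        [∀ n, IsProbabilityMeasure (P n)] (ξ : (n : ℕ) → ℕ → Ω' n → ℝ)
        {Ω : Type*} [MeasurableSpace Ω] (μ : Measure Ω) [IsProbabilityMeasure μ]
        (X : ℝ → Ω → ℝ), IsWalkLimit α c lam b T P ξ μ X →
      ∀ (m : ℕ) (t : Fin (m + 1) → ℝ) (k : Fin m → ℕ),
      StrictMono t → t 0 = 0 → t (Fin.last m) ≤ T → (∀ i, 1 ≤ k i) →
      (∀ i : Fin m, ∀ᶠ d in 𝓝[>] (0 : ℝ),
        Integrable (fun ω ↦ (X (t i.succ) ω - X (t i.succ - d) ω) ^ k i) μ) ∧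
      Tendsto
        (fun d ↦
          (∫ ω, ∏ i : Fin m, (Xs (t i.succ) ω - Xs (t i.succ - d) ω) ^ k i ∂μs) /
          ∏ i : Fin m, ∫ ω, (X (t i.succ) ω - X (t i.succ - d) ω) ^ k i ∂μ)
        (𝓝[>] (0 : ℝ))
        (𝓝 (Real.exp (-lam * t (Fin.last m)) *
          (c / (c * b * Real.exp (-lam * T) * T ^ (α - 1))) ^ m *
          ∏ i : Fin m, (t i.succ - t i.castSucc) ^ (α - 1)))) := by

  -- the main term for the increments of `X^*` in the form of the statement
  have hform : ∀ (m : ℕ) (t : Fin (m + 1) → ℝ) (k : Fin m → ℕ) (d : ℝ), 0 < d →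
      (∏ i, ((k i + 1).factorial : ℝ)) *
        ((∏ i : Fin m, c * (t i.succ - t i.castSucc) ^ (α - 1) * blockMass α c (k i) d) *
          Real.exp (-lam * t (Fin.last m))) =
      d ^ (∑ i, (α * (((k i + 1 : ℕ) : ℝ) - 1) + 1)) * Real.exp (-lam * t (Fin.last m)) *
        ∏ i : Fin m,
          ((k i + 1).factorial * (c * Real.Gamma α) ^ (k i + 1 - 1) /
              Real.Gamma ((((k i + 1 : ℕ) : ℝ) - 1) * α + 2) *
            (c * (t i.succ - t i.castSucc) ^ (α - 1))) := by
    intro m t k d hd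
    rw [Real.rpow_sum_of_pos hd, ← mul_assoc, ← Finset.prod_mul_distrib, mul_right_comm,
      ← Finset.prod_mul_distrib]
    congr 1
    refine Finset.prod_congr rfl fun i _ ↦ ?_
    rw [blockMass, Nat.add_sub_cancel, show (((k i + 1 : ℕ) : ℝ) - 1) = k i by push_cast; ring,
      mul_comm α]
    ring
  have hincr : ∀ (m : ℕ) (t : Fin (m + 1) → ℝ) (k : Fin m → ℕ),
      StrictMono t → t 0 = 0 → (∀ i, 1 ≤ k i) →
      (∀ᶠ d in 𝓝[>] (0 : ℝ), Integrable
        (fun ω ↦ ∏ i : Fin m, (Xs (t i.succ) ω - Xs (t i.succ - d) ω) ^ k i) μs) ∧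
      (fun d ↦ ∫ ω, ∏ i : Fin m, (Xs (t i.succ) ω - Xs (t i.succ - d) ω) ^ k i ∂μs)
        ~[𝓝[>] (0 : ℝ)]
      (fun d ↦ d ^ (∑ i, (α * ((k i : ℝ) - 1) + 1)) * Real.exp (-lam * t (Fin.last m)) *
        ∏ i : Fin m,
          ((k i).factorial * (c * Real.Gamma α) ^ (k i - 1) /
              Real.Gamma (((k i : ℝ) - 1) * α + 2) *
            (c * (t i.succ - t i.castSucc) ^ (α - 1)))) := by
    intro m t k ht ht0 hk
    obtain ⟨k, rfl⟩ : ∃ k' : Fin m → ℕ, k = fun i ↦ k' i + 1 :=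
      ⟨fun i ↦ k i - 1, funext fun i ↦ (Nat.sub_add_cancel (hk i)).symm⟩
    have h := hXs.increments hα0 hα1 hc0 ht ht0 k
    exact ⟨h.1, h.2.congr_right (eventually_mem_nhdsWithin.mono fun d hd ↦ hform m t k d hd)⟩
  refine ⟨fun k t hk ht ↦ hXs.moment hα0 hα1 hc0 hk ht, fun t s ht hts ↦ ?_, fun s t hs ht ↦ ?_,
    hincr, ?_⟩
  · have h := hXs.mixed_moment hα0 hα1 hc0 ht hts
    refine ⟨h.1, h.2, ?_⟩
    rw [hXs.covariance_eq hα0 hα1 hc0 ht hts, h.2]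
  · have hmono : StrictMono (![0, s, s + t] : Fin 3 → ℝ) := by
      rw [Fin.strictMono_iff_lt_succ]
      intro i
      fin_cases i
      · simpa using hs
      · simpa using ht
    have h := hincr 2 ![0, s, s + t] (fun _ ↦ 1) hmono rfl fun _ ↦ le_rfl
    have h1 : (Fin.last 2 : Fin 3) = 2 := rfl
    have hs1 : ((1 : Fin 2).succ : Fin 3) = 2 := rfl
    have hc1 : ((1 : Fin 2).castSucc : Fin 3) = 1 := rfl
    simp only [Fin.prod_univ_two, Fin.sum_univ_two, pow_one, Fin.succ_zero_eq_one, hs1, hc1, h1,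
      Fin.castSucc_zero, Matrix.cons_val_zero, Matrix.cons_val_one, Matrix.cons_val] at h
    refine ⟨h.1, h.2.congr_right (Eventually.of_forall fun d ↦ ?_)⟩
    simp only [Nat.cast_one, sub_self, mul_zero, zero_add, zero_mul, Real.Gamma_two,
      Nat.factorial_one, sub_zero, add_sub_cancel_left, div_one, one_mul]
    rw [show (1 : ℝ) + 1 = (2 : ℕ) by norm_num, Real.rpow_natCast]
    ring
  · intro b hb _ Ω' _ P _ ξ Ω _ μ _ X hX m t k ht ht0 htT hk
    obtain ⟨k, rfl⟩ : ∃ k' : Fin m → ℕ, k = fun i ↦ k' i + 1 :=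
      ⟨fun i ↦ k i - 1, funext fun i ↦ (Nat.sub_add_cancel (hk i)).symm⟩
    have hnum := (hXs.increments hα0 hα1 hc0 ht ht0 k).2
    have hden := fun i : Fin m ↦ hX.increment hα0 hα1 hc0 hT (t := t i.succ)
      (by rw [← ht0]; exact ht (Fin.succ_pos i)) ((ht.monotone (Fin.le_last _)).trans htT) (k i)
    refine ⟨fun i ↦ (hden i).1, ?_⟩
    have hratio := hnum.div (IsEquivalent.finsetProd (s := Finset.univ) fun i _ ↦ (hden i).2)
    have ha : 0 < c * b * Real.exp (-lam * T) * T ^ (α - 1) := by positivity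
    set aT := c * b * Real.exp (-lam * T) * T ^ (α - 1) with haT
    refine ((hratio.congr_right ?_).tendsto_const).congr fun d ↦ ?_
    · filter_upwards [eventually_mem_nhdsWithin] with d hd
      simp only [Pi.div_apply, Function.const_apply]
      rw [div_eq_iff]
      · have hpow : (c / aT) ^ m = ∏ _i : Fin m, c / aT := (Fin.prod_const m (c / aT)).symm
        rw [hpow, mul_assoc (Real.exp _), mul_assoc (Real.exp _), ← Finset.prod_mul_distrib,
          ← Finset.prod_mul_distrib, ← mul_assoc, ← Finset.prod_mul_distrib,
          mul_comm (Real.exp _)]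
        congr 1
        refine Finset.prod_congr rfl fun i _ ↦ ?_
        field_simp
      · refine (Finset.prod_pos fun i _ ↦ ?_).ne'
        have := blockMass_pos hα0 hc0 (k i) hd
        positivity
    · simp only [Pi.div_apply]
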